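/- Let $\mathcal F$ be a set of function symbols, each with a fixed arity and each denoted by its own binary string (its name, distinct symbols having distinct names); $\mathcal F$ may be finite or infinite. Let $\mathcal X$ be a denumerable set of variables. A permutation equation is an equation $f(x_1,\dots,x_n)\approx f(x_{\rho(1)},\dots,x_{\rho(n)})$ with $f\in\mathcal F$ of arity $n$, distinct variables $x_1,\dots,x_n$ and a permutation $\rho$ of $\{1,\dots,n\}$. Fix a finite set $E$ of permutation equations and a (possibly empty) finite set of binary symbols $g\in\mathcal F$, the interpreted symbols. To each interpreted symbol $g$ one of the following sets of equations is assigned: idempotency $I=\{g(x,x)\approx x\}$, nilpotency $N=\{g(x,x)\approx 0\}$, unit $U=\{g(x,0)\approx x,\ g(0,x)\approx x\}$, $I\cup U$, or $N\cup U$, where $0\in\mathcal F$ is a constant (which may depend on $g$). Let $B$ be the union of these sets. Then the word problem for finite sets of ground equations modulo $E\cup B$ is decidable in polynomial time: there is a (multi-stack) Turing machine, depending only on $\mathcal F$ with its names, $E$ and $B$, which, given a finite set $P$ of ground equations over $\mathcal F$ and two ground terms $s,t$ over $\mathcal F$, decides in time polynomial in the length of the input $(P,s,t)$ whether $s\approx_{P\cup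 E\cup B}t$. Here $\approx_{S}$ is the least congruence on the terms over $\mathcal F$ and $\mathcal X$ that is stable under substitutions and contains $S$, a term $f(t_1,\dots,t_n)$ is written as a bracketed string consisting of the name of $f$ followed by $t_1,\dots,t_n$, and the input is the concatenation of $s$, $t$ and both sides of each equation of $P$. -/

import Mathlib

namespace PermWord

/-- An equation `s ≈ t` between first-order terms over the function symbols of `L`, with variables
from the denumerable set `ℕ`.  Only the function symbols of `L` (each with its fixed arity) matter;
its relation symbols are irrelevant. -/
abbrev Equation (L : FirstOrder.Language.{0, 0}) : Type := L.Term ℕ × L.Term ℕ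

/-- A ground term: a term without variables. -/
abbrev GroundTerm (L : FirstOrder.Language.{0, 0}) : Type := L.Term Empty

/-- A ground term, regarded as a term over the variables `ℕ`. -/
def toTerm {L : FirstOrder.Language.{0, 0}} (t : GroundTerm L) : L.Term ℕ :=
  t.relabel Empty.elim

/-- The equational theory induced by `S`: the least congruence on terms that is stable under
substitutions and contains `S`. -/
inductive EqTheory {L : FirstOrder.Language.{0, 0}} (S : Set (Equation L)) : L.Term ℕ → L.Term ℕ → Prop
  | base {s t : L.Term ℕ} (h : (s, t) ∈ S) : EqTheory S s t
  | refl (t : L.Term ℕ) : EqTheory S t t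
  | symm {s t : L.Term ℕ} (h : EqTheory S s t) : EqTheory S t s
  | trans {s t u : L.Term ℕ} (h : EqTheory S s t) (h' : EqTheory S t u) : EqTheory S s u
  | congr {n : ℕ} (f : L.Functions n) (ss ts : Fin n → L.Term ℕ)
      (h : ∀ i, EqTheory S (ss i) (ts i)) : EqTheory S (.func f ss) (.func f ts)
  | subst {s t : L.Term ℕ} (σ : ℕ → L.Term ℕ) (h : EqTheory S s t) :
      EqTheory S (s.subst σ) (t.subst σ)

/-- `e` is a permutation equation `f(x₁,…,xₙ) ≈ f(x_{ρ(1)},…,x_{ρ(n)})`, where `x₁,…,xₙ` are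
distinct variables and `ρ` is a permutation of the indices. -/
def IsPermutationEquation {L : FirstOrder.Language.{0, 0}} (e : Equation L) : Prop :=
  ∃ (n : ℕ) (f : L.Functions n) (ρ : Equiv.Perm (Fin n)) (x : Fin n → ℕ),
    Function.Injective x ∧
      e = (.func f fun i => .var (x i), .func f fun i => .var (x (ρ i)))

/-- The properties a binary interpreted function symbol may have:
`I`, `N`, `U`, `I ∪ U` or `N ∪ U`; all but `I` mention a constant `z` (the `0` of the symbol). -/
inductive InterpretedBy (L : FirstOrder.Language.{0, 0}) : Type
  | idem
  | nilp (z : L.Constants)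
  | unit (z : L.Constants)
  | idemUnit (z : L.Constants)
  | nilpUnit (z : L.Constants)

/-- Idempotency `g(x, x) ≈ x`. -/
def idemRules {L : FirstOrder.Language.{0, 0}} (g : L.Functions 2) : Set (Equation L) :=
  {(g.apply₂ (.var 0) (.var 0), .var 0)}

/-- Nilpotency `g(x, x) ≈ z`. -/
def nilpRules {L : FirstOrder.Language.{0, 0}} (g : L.Functions 2) (z : L.Constants) : Set (Equation L) :=
  {(g.apply₂ (.var 0) (.var 0), z.term)}

/-- Unit `g(x, z) ≈ x` and `g(z, x) ≈ x`. -/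
def unitRules {L : FirstOrder.Language.{0, 0}} (g : L.Functions 2) (z : L.Constants) : Set (Equation L) :=
  {(g.apply₂ (.var 0) z.term, .var 0), (g.apply₂ z.term (.var 0), .var 0)}

/-- The rules for the interpreted function symbol `g` with a given property. -/
def symbolRules {L : FirstOrder.Language.{0, 0}} (g : L.Functions 2) : InterpretedBy L → Set (Equation L)
  | .idem => idemRules g
  | .nilp z => nilpRules g z
  | .unit z => unitRules g z
  | .idemUnit z => idemRules g ∪ unitRules g z
  | .nilpUnit z => nilpRules g z ∪ unitRules g z

/-- All the rules given by an assignment of properties to binary function symbols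
(`none` means that the symbol is not interpreted). -/
def rules {L : FirstOrder.Language.{0, 0}} (B : L.Functions 2 → Option (InterpretedBy L)) :
    Set (Equation L) :=
  {e | ∃ g p, B g = some p ∧ e ∈ symbolRules g p}

/-- An input of the word problem: a finite set `P` of ground equations (given as a list) and the
two ground terms to be compared. -/
structure Input (L : FirstOrder.Language.{0, 0}) : Type where
  P : List (GroundTerm L × GroundTerm L)
  s : GroundTerm L
  t : GroundTerm L

/-- The finite set of ground equations of an input, as a set of equations. -/
def Input.equations {L : FirstOrder.Language.{0, 0}} (w : Input L) : Set (Equation L) :=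
  {e | ∃ p ∈ w.P, e = (toTerm p.1, toTerm p.2)}

open Classical in
/-- The word problem: is `s` equal to `t` modulo the equations in `P`, `E` and `B`? -/
noncomputable def wordProblem {L : FirstOrder.Language.{0, 0}} (E : Set (Equation L))
    (B : L.Functions 2 → Option (InterpretedBy L)) (w : Input L) : Bool :=
  decide (EqTheory (w.equations ∪ E ∪ rules B) (toTerm w.s) (toTerm w.t))

/-- The input alphabet: two parentheses and two bits. -/
inductive Letter : Type
  | lp
  | rp
  | bit (b : Bool)
  deriving DecidableEq

/-- A ground term `f(t₁,…,tₙ)` is written as `(` name of `f`, `t₁`, …, `tₙ` `)`, where the name of a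
function symbol is a binary string. -/
def encodeTerm {L : FirstOrder.Language.{0, 0}} (name : (Σ n, L.Functions n) → List Bool) :
    GroundTerm L → List Letter
  | .var a => a.elim
  | .func (l := n) f ts =>
      .lp :: ((name ⟨n, f⟩).map .bit ++ (List.ofFn fun i => encodeTerm name (ts i)).flatten ++ [.rp])

/-- An input is written as `s`, `t`, followed by the two sides of every equation of `P`. -/
def encodeInput {L : FirstOrder.Language.{0, 0}} (name : (Σ n, L.Functions n) → List Bool) (w : Input L) :
    List Letter :=
  encodeTerm name w.s ++ encodeTerm name w.t ++
    (w.P.map fun p => encodeTerm name p.1 ++ encodeTerm name p.2).flatten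

end PermWord

/-! The word problem is decided by congruence closure on a finite list `T` of ground terms: the
subterms of the input together with the constants `0` of the interpreted symbols. Starting from the
empty relation, each round keeps the pairs of `T` that follow in one `step` from the pairs found so
far: by reflexivity, by a common related term, by `P`, by congruence, by congruence up to a
permutation valid modulo `E`, or by a rule of an interpreted symbol. Each round is a monotone filter
of the same |T|² pairs, so |T|² rounds reach a fixed point (`exists_fixpoint`).

Soundness (`closure_sound`) is an induction on the rounds. Completeness (`IsClosure.complete`) says
that derivations through terms outside `T` prove nothing new about `T`; it comes from a model. The
classes of `T` form a partial algebra, in which a symbol is defined on given classes if some term of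
`T` has arguments in these classes up to an allowed permutation. The value is unique because the
allowed permutations form a group. The partial algebra is completed on sets of ground terms, with
the empty set as junk value, by letting an interpreted symbol obey its own rules wherever nothing is
prescribed. The values added are symmetric in the two arguments, so the permutation equations
survive, and the unit rule agrees with idempotency or nilpotency on the overlap g(0,0). The total
algebra satisfies `P`, `E` and `B` and sends every term of `T` to its class, so terms of `T` that
are equal modulo the theory are related.

For the complexity, structured programs are compiled to `TM2` machines with exact step counts
(`Run.iterate_step`). `PolyTime` is closed under composition, pairing, case distinction, and folds
with polynomially bounded intermediate results. The last condition holds for the closure since every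
round yields a sublist of the pairs of `T`. The valid permutations and the interpreted symbols are
finite data wired into the program. A single right-to-left pass parses the input and lists its
subterms, and `PolyTime.nonempty_tm2` produces the machine. -/

namespace PermWord

/-! ### Structured programs and their compilation to multi-stack machines. -/

section Programs

variable {K : Type} [DecidableEq K] {Γ : K → Type} {σ : Type}

/-- Structured programs over a finite register and finitely many stacks. -/
inductive Prog (Γ : K → Type) (σ : Type) : Type
  | push (k : K) (f : σ → Γ k)
  | pop (k : K) (f : σ → Option (Γ k) → σ)
  | load (f : σ → σ)
  | seq (p q : Prog Γ σ)
  | ite (c : σ → Bool) (p q : Prog Γ σ)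
  | loop (c : σ → Bool) (p : Prog Γ σ)

/-- `Run p v S v' S' n`: the program `p` transforms the register `v` and the stacks `S` into `v'`
and `S'` in `n` steps. -/
inductive Run : Prog Γ σ → σ → (∀ k, List (Γ k)) → σ → (∀ k, List (Γ k)) → ℕ → Prop
  | push (k : K) (f : σ → Γ k) (v S) :
      Run (.push k f) v S v (Function.update S k (f v :: S k)) 1
  | pop (k : K) (f : σ → Option (Γ k) → σ) (v S) :
      Run (.pop k f) v S (f v (S k).head?) (Function.update S k (S k).tail) 1
  | load (f : σ → σ) (v S) : Run (.load f) v S (f v) S 1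
  | seq {p q v S v₁ S₁ v₂ S₂ m n} (hp : Run p v S v₁ S₁ m) (hq : Run q v₁ S₁ v₂ S₂ n) :
      Run (.seq p q) v S v₂ S₂ (m + n)
  | iteTrue {c p q v S v' S' n} (hc : c v = true) (hp : Run p v S v' S' n) :
      Run (.ite c p q) v S v' S' (n + 1)
  | iteFalse {c p q v S v' S' n} (hc : c v = false) (hq : Run q v S v' S' n) :
      Run (.ite c p q) v S v' S' (n + 1)
  | loopFalse {c p v S} (hc : c v = false) : Run (.loop c p) v S v S 1
  | loopTrue {c p v S v₁ S₁ v₂ S₂ m n} (hc : c v = true) (hp : Run p v S v₁ S₁ m)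
      (hl : Run (.loop c p) v₁ S₁ v₂ S₂ n) : Run (.loop c p) v S v₂ S₂ (m + 1 + n)

namespace Prog

/-- The labels of the machine that executes a program. -/
def Lab : Prog Γ σ → Type
  | push _ _ => Unit
  | pop _ _ => Unit
  | load _ => Unit
  | seq p q => p.Lab ⊕ q.Lab
  | ite _ p q => Option (p.Lab ⊕ q.Lab)
  | loop _ p => Option p.Lab

instance finite_lab : ∀ p : Prog Γ σ, Finite p.Lab
  | push _ _ => inferInstanceAs (Finite Unit)
  | pop _ _ => inferInstanceAs (Finite Unit)
  | load _ => inferInstanceAs (Finite Unit)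
  | seq p q =>
    have := finite_lab p
    have := finite_lab q
    inferInstanceAs (Finite (p.Lab ⊕ q.Lab))
  | ite _ p q =>
    have := finite_lab p
    have := finite_lab q
    inferInstanceAs (Finite (Option (p.Lab ⊕ q.Lab)))
  | loop _ p =>
    have := finite_lab p
    inferInstanceAs (Finite (Option p.Lab))

/-- The label at which the execution of a program starts. -/
def entry : ∀ p : Prog Γ σ, p.Lab
  | push _ _ => ()
  | pop _ _ => ()
  | load _ => ()
  | seq p _ => Sum.inl p.entry
  | ite _ _ _ => none
  | loop _ _ => none

open Turing

/-- The machine code of a program whose labels are embedded into `Λ` and which continues with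
`exit`. -/
def code {Λ : Type} : ∀ p : Prog Γ σ, (p.Lab → Λ) → TM2.Stmt Γ Λ σ → p.Lab → TM2.Stmt Γ Λ σ
  | push k f, _, exit => fun _ => .push k f exit
  | pop k f, _, exit => fun _ => .pop k f exit
  | load f, _, exit => fun _ => .load f exit
  | seq p q, emb, exit => Sum.elim
      (p.code (fun l => emb (Sum.inl l)) (.goto fun _ => emb (Sum.inr q.entry)))
      (q.code (fun l => emb (Sum.inr l)) exit)
  | ite c p q, emb, exit => fun l => Option.elim l
      (.branch c (.goto fun _ => emb (some (Sum.inl p.entry)))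
        (.goto fun _ => emb (some (Sum.inr q.entry))))
      (Sum.elim (p.code (fun l => emb (some (Sum.inl l))) exit)
        (q.code (fun l => emb (some (Sum.inr l))) exit))
  | loop c p, emb, exit => fun l => Option.elim l
      (.branch c (.goto fun _ => emb (some p.entry)) exit)
      (p.code (fun l => emb (some l)) (.goto fun _ => emb none))

end Prog

open Turing

theorem iterate_bind_add {X : Type} {f : X → Option X} {m n : ℕ} {a b : X} {c : Option X}
    (h₁ : (flip bind f)^[m] (some a) = some b) (h₂ : (flip bind f)^[n] (some b) = c) :
    (flip bind f)^[m + n] (some a) = c := by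
  rw [add_comm, Function.iterate_add_apply, h₁, h₂]

/-- The machine code of a program executes the program. -/
theorem Run.iterate_step {Λ : Type} {M : Λ → TM2.Stmt Γ Λ σ} {p : Prog Γ σ} {v v' : σ}
    {S S' : ∀ k, List (Γ k)} {n : ℕ} (h : Run p v S v' S' n) :
    ∀ (emb : p.Lab → Λ) (exit : TM2.Stmt Γ Λ σ), (∀ l, M (emb l) = p.code emb exit l) →
      (flip bind (TM2.step M))^[n] (some ⟨some (emb p.entry), v, S⟩) =
        some (TM2.stepAux exit v' S') := by
  -- One machine step executes the whole statement at the entry label. The statement `exit` runs in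
  -- the same step as the last command, so the counts in `Run` are exact.
  have first : ∀ {p : Prog Γ σ} (emb : p.Lab → Λ) (exit : TM2.Stmt Γ Λ σ) (v S)
      (c : Option (TM2.Cfg Γ Λ σ)) (n : ℕ), (∀ l, M (emb l) = p.code emb exit l) →
      (flip bind (TM2.step M))^[n] (some (TM2.stepAux (p.code emb exit p.entry) v S)) = c →
      (flip bind (TM2.step M))^[n + 1] (some ⟨some (emb p.entry), v, S⟩) = c := by
    intro p emb exit v S c n hM hc
    rw [Function.iterate_succ_apply]
    exact (congrArg _ (congrArg some (congrArg (fun s => TM2.stepAux s v S) (hM _)))).trans hc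
  induction h with
  | push k f v S => exact fun emb exit hM => first emb exit v S _ 0 hM rfl
  | pop k f v S => exact fun emb exit hM => first emb exit v S _ 0 hM rfl
  | load f v S => exact fun emb exit hM => first emb exit v S _ 0 hM rfl
  | seq hp hq ihp ihq =>
    intro emb exit hM
    have h₁ := ihp (fun l => emb (Sum.inl l)) _ fun l => hM (Sum.inl l)
    have h₂ := ihq (fun l => emb (Sum.inr l)) exit fun l => hM (Sum.inr l)
    exact iterate_bind_add h₁ h₂
  | iteTrue hc hp ih =>
    intro emb exit hM
    refine first emb exit _ _ _ _ hM ?_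
    simp only [Prog.entry, Prog.code, Option.elim, TM2.stepAux, hc, cond_true]
    exact ih (fun l => emb (some (Sum.inl l))) exit fun l => hM (some (Sum.inl l))
  | iteFalse hc hp ih =>
    intro emb exit hM
    refine first emb exit _ _ _ _ hM ?_
    simp only [Prog.entry, Prog.code, Option.elim, TM2.stepAux, hc, cond_false]
    exact ih (fun l => emb (some (Sum.inr l))) exit fun l => hM (some (Sum.inr l))
  | loopFalse hc =>
    intro emb exit hM
    refine first emb exit _ _ _ 0 hM ?_
    simp only [Prog.entry, Prog.code, Option.elim, TM2.stepAux, hc, cond_false]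
    rfl
  | loopTrue hc hp hl ihp ihl =>
    intro emb exit hM
    refine iterate_bind_add (first emb exit _ _ _ _ hM ?_) (ihl emb exit hM)
    simp only [Prog.entry, Prog.code, Option.elim, TM2.stepAux, hc, cond_true]
    exact ihp (fun l => emb (some l)) _ fun l => hM (some l)

end Programs

/-! ### Binary trees as data. -/

/-- Binary trees, the data on which programs operate. -/
inductive BTree : Type
  | nil
  | node (l r : BTree)

namespace BTree

/-- The prefix code of a binary tree. -/
def code : BTree → List Bool
  | nil => [false]
  | node l r => true :: (l.code ++ r.code)

/-- The number of nodes and leaves of a binary tree. -/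
def size : BTree → ℕ
  | nil => 1
  | node l r => l.size + r.size + 1

@[simp] theorem length_code : ∀ t : BTree, t.code.length = t.size
  | nil => rfl
  | node l r => by simp [code, size, length_code l, length_code r]

theorem one_le_size : ∀ t : BTree, 1 ≤ t.size
  | nil => le_rfl
  | node _ _ => Nat.le_add_left _ _

/-- The code is self-delimiting: the first bit tells a leaf from a node, and the code of the left
subtree determines where the right one begins. Trees can therefore be stacked without separators. -/
theorem code_append_inj : ∀ {s t : BTree} {r r' : List Bool},
    s.code ++ r = t.code ++ r' → s = t ∧ r = r'
  | nil, nil, _, _, h => ⟨rfl, by simpa [code] using h⟩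
  | nil, node _ _, _, _, h => by simp [code] at h
  | node _ _, nil, _, _, h => by simp [code] at h
  | node a b, node c d, r, r', h => by
    simp only [code, List.cons_append, List.append_assoc, List.cons.injEq, true_and] at h
    obtain ⟨rfl, h₁⟩ := code_append_inj h
    obtain ⟨rfl, h₂⟩ := code_append_inj h₁
    exact ⟨rfl, h₂⟩

theorem code_injective : Function.Injective code := fun s t h =>
  (code_append_inj (r := []) (r' := []) (by simpa using h)).1

end BTree

/-! ### Stack layout and basic operations on stacked trees. -/

/-- The working stacks. -/
inductive WStk : Type
  | main
  | a
  | b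
  | c
  | cnt
  deriving DecidableEq

instance : Fintype WStk := ⟨{.main, .a, .b, .c, .cnt}, fun x => by cases x <;> simp⟩

/-- The stacks of the machine: the input stack and the working stacks. -/
inductive Stk : Type
  | inp
  | wk (i : WStk)
  deriving DecidableEq

instance : Fintype Stk := ⟨insert .inp (Finset.univ.image .wk), fun x => by cases x <;> simp⟩

/-- The alphabets of the stacks. -/
abbrev Sig : Stk → Type
  | .inp => Letter
  | .wk _ => Bool

/-- The register: two bits and a letter, each of which may be absent. -/
abbrev Reg : Type := Option Bool × Option Bool × Option Letter

abbrev Prg : Type := Prog Sig Reg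

/-- The stacks, given the content of the input stack and of the working stacks. -/
def store (I : List Letter) (S : WStk → List Bool) : ∀ k, List (Sig k)
  | .inp => I
  | .wk i => S i

theorem update_store_wk (I : List Letter) (S : WStk → List Bool) (i : WStk) (l : List Bool) :
    Function.update (store I S) (.wk i) l = store I (Function.update S i l) := by
  funext k
  rcases k with _ | j
  · rfl
  · by_cases h : j = i
    · subst h; simp [store]
    · simp [store, h]

theorem update_store_inp (I J : List Letter) (S : WStk → List Bool) :
    Function.update (store I S) .inp J = store J S := by
  funext k
  rcases k with _ | j <;> simp [store]

/-- Execution of a program when the input stack contains `I`. -/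
abbrev ExecI (p : Prg) (v : Reg) (I : List Letter) (S : WStk → List Bool) (v' : Reg)
    (I' : List Letter) (S' : WStk → List Bool) (n : ℕ) : Prop :=
  Run p v (store I S) v' (store I' S') n

/-- Execution of a program when the input stack is empty. -/
abbrev Exec (p : Prg) (v : Reg) (S : WStk → List Bool) (v' : Reg) (S' : WStk → List Bool)
    (n : ℕ) : Prop :=
  ExecI p v [] S v' [] S' n

/-- The empty register. -/
abbrev r0 : Reg := (none, none, none)

/-- The working stacks with given contents. -/
def ws (m a b c d : List Bool) : WStk → List Bool
  | .main => m
  | .a => a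
  | .b => b
  | .c => c
  | .cnt => d

/-- The working stacks when only the main stack may be nonempty. -/
abbrev ms (m : List Bool) : WStk → List Bool := ws m [] [] [] []

section ws
variable (m a b c d x : List Bool)

@[simp] theorem ws_main : ws m a b c d .main = m := rfl
@[simp] theorem ws_a : ws m a b c d .a = a := rfl
@[simp] theorem ws_b : ws m a b c d .b = b := rfl
@[simp] theorem ws_c : ws m a b c d .c = c := rfl
@[simp] theorem update_ws_main : Function.update (ws m a b c d) .main x = ws x a b c d := by
  funext k; cases k <;> rfl
@[simp] theorem update_ws_a : Function.update (ws m a b c d) .a x = ws m x b c d := by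
  funext k; cases k <;> rfl
@[simp] theorem update_ws_b : Function.update (ws m a b c d) .b x = ws m a x c d := by
  funext k; cases k <;> rfl
@[simp] theorem update_ws_c : Function.update (ws m a b c d) .c x = ws m a b x d := by
  funext k; cases k <;> rfl

end ws

namespace Prg

/-- Pop a bit into the first register. -/
def popX (i : WStk) : Prg := .pop (.wk i) fun v o => (o, v.2)
/-- Pop a bit into the second register. -/
def popY (i : WStk) : Prg := .pop (.wk i) fun v o => (v.1, o, v.2.2)
/-- Push the bit in the first register. -/
def pushX (i : WStk) : Prg := .push (.wk i) fun v => v.1.getD false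
/-- Push a fixed bit. -/
def pushC (i : WStk) (b : Bool) : Prg := .push (.wk i) fun _ => b
/-- Reset the register. -/
def reset : Prg := .load fun _ => r0

/-- Move the content of a stack to another one, in reverse order. -/
def unload (i j : WStk) : Prg :=
  .seq (popX i) (.loop (fun v => v.1.isSome) (.seq (pushX j) (popX i)))
/-- Move the content of a stack to two other stacks, in reverse order. -/
def unload₂ (i j k : WStk) : Prg :=
  .seq (popX i) (.loop (fun v => v.1.isSome) (.seq (pushX j) (.seq (pushX k) (popX i))))
/-- Clear a stack. -/
def clear (i : WStk) : Prg := .seq (popX i) (.loop (fun v => v.1.isSome) (popX i))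
/-- Move the topmost tree of the main stack to another stack, in reverse order. -/
def moveTop (i : WStk) : Prg :=
  .seq (.load fun v => (some false, v.2)) (.loop (fun v => v.1.isSome)
    (.seq (popX .main) (.seq (pushX i)
      (.ite (fun v => v.1 == some true) (pushC .cnt true) (popX .cnt)))))
/-- Exchange the two topmost trees. -/
def swap : Prg := .seq (moveTop .a) (.seq (moveTop .b) (.seq (unload .a .main) (unload .b .main)))
/-- Delete the topmost tree. -/
def drop : Prg := .seq (moveTop .a) (clear .a)
/-- Duplicate the topmost tree. -/
def dup : Prg :=
  .seq (moveTop .a) (.seq (unload₂ .a .main .b) (.seq (unload .b .a) (unload .a .main)))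
/-- Exchange the second and the third tree. -/
def swap₂₃ : Prg :=
  .seq (moveTop .a) (.seq (moveTop .b) (.seq (moveTop .c)
    (.seq (unload .b .main) (.seq (unload .c .main) (unload .a .main)))))

end Prg

section exec
variable {v : Reg} {I : List Letter} {S S' : WStk → List Bool} {i j k : WStk}

theorem exec_popX : ExecI (Prg.popX i) v I S ((S i).head?, v.2) I
    (Function.update S i (S i).tail) 1 := by
  have h := Run.pop (Γ := Sig) (.wk i) (fun (v : Reg) o => (o, v.2)) v (store I S)
  rw [update_store_wk] at h
  exact h

theorem exec_popY : ExecI (Prg.popY i) v I S (v.1, (S i).head?, v.2.2) I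
    (Function.update S i (S i).tail) 1 := by
  have h := Run.pop (Γ := Sig) (.wk i) (fun (v : Reg) o => (v.1, o, v.2.2)) v (store I S)
  rw [update_store_wk] at h
  exact h

theorem exec_pushX : ExecI (Prg.pushX i) v I S v I
    (Function.update S i (v.1.getD false :: S i)) 1 := by
  have h := Run.push (Γ := Sig) (.wk i) (fun (v : Reg) => v.1.getD false) v (store I S)
  rw [update_store_wk] at h
  exact h

theorem exec_pushC {b : Bool} : ExecI (Prg.pushC i b) v I S v I
    (Function.update S i (b :: S i)) 1 := by
  have h := Run.push (Γ := Sig) (.wk i) (fun (_ : Reg) => b) v (store I S)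
  rw [update_store_wk] at h
  exact h

theorem exec_reset : ExecI Prg.reset v I S r0 I S 1 := Run.load _ _ _

theorem exec_unload (hij : i ≠ j)
    (hS' : S' = Function.update (Function.update S j ((S i).reverse ++ S j)) i []) :
    Exec (Prg.unload i j) r0 S r0 S' (3 * (S i).length + 2) := by
  subst hS'
  -- Loop invariant: the next bit is in the register and stack `i` holds only the bits after it; an
  -- exhausted stack shows up as an empty register.
  have main : ∀ (l : List Bool) (S : WStk → List Bool), S i = l.tail →
      Exec (.loop (fun v => v.1.isSome) (.seq (Prg.pushX j) (Prg.popX i))) (l.head?, none, none) S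
        r0 (Function.update (Function.update S j (l.reverse ++ S j)) i []) (3 * l.length + 1) := by
    intro l
    induction l with
    | nil =>
      intro S hS
      have : Function.update (Function.update S j ([].reverse ++ S j)) i [] = S := by
        funext k
        by_cases hk : k = i
        · subst hk; simpa using hS.symm
        · simp [hk]
      rw [this]
      exact Run.loopFalse rfl
    | cons x l ih =>
      intro S hS
      have h₁ := exec_pushX (i := j) (v := (some x, none, none)) (I := []) (S := S)
      have h₂ := exec_popX (i := i) (v := (some x, none, none)) (I := [])
        (S := Function.update S j (x :: S j))
      have hi : Function.update S j (x :: S j) i = l := by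
        simpa [Function.update_of_ne hij] using hS
      rw [hi] at h₂
      have h₃ := ih (Function.update (Function.update S j (x :: S j)) i l.tail) (by simp)
      have h := Run.loopTrue (c := fun v : Reg => v.1.isSome) (by rfl) (Run.seq h₁ h₂) h₃
      have e : Function.update (Function.update (Function.update (Function.update S j (x :: S j)) i
          l.tail) j (l.reverse ++ (Function.update (Function.update S j (x :: S j)) i l.tail) j)) i []
          = Function.update (Function.update S j ((x :: l).reverse ++ S j)) i [] := by
        funext k
        by_cases hk : k = i
        · subst hk; simp
        · by_cases hk' : k = j
          · subst hk'; simp [hk]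
          · simp [hk, hk']
      rw [e] at h
      have e' : 1 + 1 + 1 + (3 * l.length + 1) = 3 * (x :: l).length + 1 := by
        simp only [List.length_cons]; omega
      rw [e'] at h
      exact h
  have h₁ := exec_popX (i := i) (v := r0) (I := []) (S := S)
  have h₂ := main (S i) (Function.update S i (S i).tail) (by simp)
  have h := Run.seq h₁ h₂
  have e : Function.update (Function.update (Function.update S i (S i).tail) j
      ((S i).reverse ++ (Function.update S i (S i).tail) j)) i [] =
      Function.update (Function.update S j ((S i).reverse ++ S j)) i [] := by
    funext k
    by_cases hk : k = i
    · subst hk; simp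
    · by_cases hk' : k = j
      · subst hk'; simp [hk]
      · simp [hk, hk']
  rw [e] at h
  have e' : 1 + (3 * (S i).length + 1) = 3 * (S i).length + 2 := by omega
  rw [e'] at h
  exact h

theorem exec_clear (hS' : S' = Function.update S i []) :
    Exec (Prg.clear i) r0 S r0 S' (2 * (S i).length + 2) := by
  subst hS'
  have main : ∀ (l : List Bool) (S : WStk → List Bool), S i = l.tail →
      Exec (.loop (fun v => v.1.isSome) (Prg.popX i)) (l.head?, none, none) S
        r0 (Function.update S i []) (2 * l.length + 1) := by
    intro l
    induction l with
    | nil =>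
      intro S hS
      have : Function.update S i [] = S := Function.update_eq_self_iff.2 hS.symm
      rw [this]
      exact Run.loopFalse rfl
    | cons x l ih =>
      intro S hS
      have h₁ := exec_popX (i := i) (v := (some x, none, none)) (I := []) (S := S)
      rw [show S i = l from hS] at h₁
      have h := Run.loopTrue (c := fun v : Reg => v.1.isSome) (by rfl) h₁
        (ih (Function.update S i l.tail) (by simp))
      rw [Function.update_idem] at h
      have e' : 1 + 1 + (2 * l.length + 1) = 2 * (x :: l).length + 1 := by
        simp only [List.length_cons]; omega
      rw [e'] at h
      exact h
  have h := Run.seq (exec_popX (i := i) (v := r0) (I := []) (S := S))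
    (main (S i) (Function.update S i (S i).tail) (by simp))
  rw [Function.update_idem] at h
  have e' : 1 + (2 * (S i).length + 1) = 2 * (S i).length + 2 := by omega
  rw [e'] at h
  exact h

theorem exec_unload₂ {l m b : List Bool} :
    Exec (Prg.unload₂ .a .main .b) r0 (ws m l b [] []) r0
      (ws (l.reverse ++ m) [] (l.reverse ++ b) [] []) (4 * l.length + 2) := by
  have main : ∀ (l m b : List Bool),
      Exec (.loop (fun v => v.1.isSome) (.seq (Prg.pushX .main) (.seq (Prg.pushX .b)
        (Prg.popX .a)))) (l.head?, none, none) (ws m l.tail b [] []) r0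
        (ws (l.reverse ++ m) [] (l.reverse ++ b) [] []) (4 * l.length + 1) := by
    intro l
    induction l with
    | nil => exact fun m b => Run.loopFalse rfl
    | cons x l ih =>
      intro m b
      have h₁ := exec_pushX (i := .main) (v := (some x, none, none)) (I := []) (S := ws m l b [] [])
      have h₂ := exec_pushX (i := .b) (v := (some x, none, none)) (I := [])
        (S := ws (x :: m) l b [] [])
      have h₃ := exec_popX (i := .a) (v := (some x, none, none)) (I := [])
        (S := ws (x :: m) l (x :: b) [] [])
      simp only [ws_main, ws_b, ws_a, update_ws_main, update_ws_b, update_ws_a, Option.getD_some]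
        at h₁ h₂ h₃
      have h := Run.loopTrue (c := fun v : Reg => v.1.isSome) (by rfl)
        (Run.seq h₁ (Run.seq h₂ h₃)) (ih (x :: m) (x :: b))
      have e' : 1 + (1 + 1) + 1 + (4 * l.length + 1) = 4 * (x :: l).length + 1 := by
        simp only [List.length_cons]; omega
      rw [e'] at h
      simpa using h
  have h₁ := exec_popX (i := .a) (v := r0) (I := []) (S := ws m l b [] [])
  simp only [ws_a, update_ws_a] at h₁
  have h := Run.seq h₁ (main l m b)
  have e' : 1 + (4 * l.length + 1) = 4 * l.length + 2 := by omega
  rw [e'] at h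
  exact h

/-- A counter suffices to find the end of a prefix code: `cnt` holds in unary the right subtrees
still to be read. Each `true` adds one and each `false` removes one; removing from the empty counter
empties the register and ends the loop. -/
theorem exec_moveTop (t : BTree) (r : List Bool) (hi : i ≠ .main) (hi' : i ≠ .cnt)
    (hS : S .main = t.code ++ r) (hc : S .cnt = [])
    (hS' : S' = Function.update (Function.update S .main r) i (t.code.reverse ++ S i)) :
    Exec (Prg.moveTop i) r0 S r0 S' (5 * t.size + 2) := by
  set F : List Bool → List Bool → List Bool → WStk → List Bool := fun m x c =>
    Function.update (Function.update (Function.update S .main m) i x) .cnt c with hF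
  have Fm : ∀ m x c, F m x c .main = m := fun m x c => by simp [hF, hi.symm]
  have Fi : ∀ m x c, F m x c i = x := fun m x c => by simp [hF, hi']
  have Fc : ∀ m x c, F m x c .cnt = c := fun m x c => by simp [hF]
  have Um : ∀ m x c y, Function.update (F m x c) .main y = F y x c := by
    intro m x c y; funext k
    by_cases h : k = .main
    · subst h; simp [Fm]
    · simp [hF, Function.update_apply, h]
  have Ui : ∀ m x c y, Function.update (F m x c) i y = F m y c := by
    intro m x c y; funext k
    by_cases h : k = i
    · subst h; simp [Fi]
    · simp [hF, Function.update_apply, h]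
  have Uc : ∀ m x c y, Function.update (F m x c) .cnt y = F m x y := by
    intro m x c y; simp [hF]
  have h0 : S = F (t.code ++ r) (S i) [] := by
    funext k
    simp only [hF, Function.update_apply]
    split_ifs with h₁ h₂ h₃
    · rw [h₁, hc]
    · rw [h₂]
    · rw [h₃, hS]
    · rfl
  have h1 : S' = F r (t.code.reverse ++ S i) [] := by
    rw [hS']
    refine (Function.update_eq_self_iff.2 ?_).symm
    simp [hi'.symm, hc]
  set body : Prg := .seq (Prg.popX .main) (.seq (Prg.pushX i)
      (.ite (fun v => v.1 == some true) (Prg.pushC .cnt true) (Prg.popX .cnt))) with hbody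
  -- Continuation form: after `t` the run goes on with one pending subtree taken off the counter, so
  -- the two subtrees of a node chain together. Each bit costs five steps.
  have main : ∀ (t : BTree) (b : Bool) (r x c : List Bool) (v' : Reg) (S' : WStk → List Bool) (n : ℕ),
      Exec (.loop (fun v => v.1.isSome) body) (c.head?, none, none)
        (F r (t.code.reverse ++ x) c.tail) v' S' n →
      Exec (.loop (fun v => v.1.isSome) body) (some b, none, none) (F (t.code ++ r) x c) v' S'
        (n + 5 * t.size) := by
    intro t
    induction t with
    | nil =>
      intro b r x c v' S' n h
      have h₁ := exec_popX (i := .main) (v := (some b, none, none)) (I := [])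
        (S := F (BTree.nil.code ++ r) x c)
      have h₂ := exec_pushX (i := i) (v := (some false, none, none)) (I := []) (S := F r x c)
      have h₃ := exec_popX (i := .cnt) (v := (some false, none, none)) (I := [])
        (S := F r (false :: x) c)
      simp only [Fm, Fi, Fc, Um, Ui, Uc, Option.getD_some, BTree.code, List.cons_append,
        List.nil_append, List.head?_cons, List.tail_cons] at h₁ h₂ h₃
      have h₄ := Run.loopTrue (c := fun v : Reg => v.1.isSome) (by rfl)
        (Run.seq h₁ (Run.seq h₂ (Run.iteFalse (c := fun v : Reg => v.1 == some true)
          (p := Prg.pushC .cnt true) (by rfl) h₃))) h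
      have e : 1 + (1 + (1 + 1)) + 1 + n = n + 5 * BTree.nil.size := by simp [BTree.size]; omega
      rw [e] at h₄
      exact h₄
    | node p q ihp ihq =>
      intro b r x c v' S' n h
      have h₁ := exec_popX (i := .main) (v := (some b, none, none)) (I := [])
        (S := F ((BTree.node p q).code ++ r) x c)
      have h₂ := exec_pushX (i := i) (v := (some true, none, none)) (I := [])
        (S := F (p.code ++ (q.code ++ r)) x c)
      have h₃ := exec_pushC (i := .cnt) (v := (some true, none, none)) (I := []) (b := true)
        (S := F (p.code ++ (q.code ++ r)) (true :: x) c)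
      simp only [Fm, Fi, Fc, Um, Ui, Uc, Option.getD_some, BTree.code, List.cons_append,
        List.head?_cons, List.tail_cons, List.append_assoc] at h₁ h₂ h₃
      have hq := ihq true r (p.code.reverse ++ true :: x) c v' S' n
        (by simpa [BTree.code] using h)
      have hp := ihp true (q.code ++ r) (true :: x) (true :: c) v' S' _ hq
      have h₄ := Run.loopTrue (c := fun v : Reg => v.1.isSome) (by rfl)
        (Run.seq h₁ (Run.seq h₂ (Run.iteTrue (c := fun v : Reg => v.1 == some true)
          (q := Prg.popX .cnt) (by rfl) h₃))) hp
      have e : 1 + (1 + (1 + 1)) + 1 + (n + 5 * q.size + 5 * p.size)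
          = n + 5 * (BTree.node p q).size := by simp only [BTree.size]; omega
      rw [e] at h₄
      simpa [BTree.code] using h₄
  have hl := main t false r (S i) [] r0 S' 1 (by rw [h1]; exact Run.loopFalse rfl)
  rw [← h0] at hl
  have h := Run.seq (Run.load (Γ := Sig) (fun v : Reg => (some false, v.2)) r0 (store [] S)) hl
  have e : 1 + (1 + 5 * t.size) = 5 * t.size + 2 := by omega
  rw [e] at h
  exact h

section trees
variable (x y z : BTree) (r : List Bool)

theorem exec_swap : ∃ n ≤ 16 * (x.size + y.size) + 16,
    Exec Prg.swap r0 (ms (x.code ++ (y.code ++ r))) r0 (ms (y.code ++ (x.code ++ r))) n := by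
  have h₁ := exec_moveTop (i := .a) (S := ms (x.code ++ (y.code ++ r))) x (y.code ++ r) (by simp)
    (by simp) rfl rfl rfl
  simp only [update_ws_main, update_ws_a, ws_a] at h₁
  have h₂ := exec_moveTop (i := .b) (S := ws (y.code ++ r) (x.code.reverse ++ []) [] [] []) y r
    (by simp) (by simp) rfl rfl rfl
  simp only [update_ws_main, update_ws_b, ws_b] at h₂
  have h₃ := exec_unload (i := .a) (j := .main) (by simp)
    (S := ws r (x.code.reverse ++ []) (y.code.reverse ++ []) [] []) rfl
  simp only [update_ws_main, update_ws_a, ws_a, ws_main] at h₃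
  have h₄ := exec_unload (i := .b) (j := .main) (by simp)
    (S := ws ((x.code.reverse ++ []).reverse ++ r) [] (y.code.reverse ++ []) [] []) rfl
  simp only [update_ws_main, update_ws_b, ws_b, ws_main] at h₄
  have h := Run.seq h₁ (Run.seq h₂ (Run.seq h₃ h₄))
  simp only [List.append_nil, List.reverse_reverse] at h
  refine ⟨_, ?_, h⟩
  simp only [List.length_reverse, BTree.length_code]
  omega

theorem exec_drop : ∃ n ≤ 8 * x.size + 8,
    Exec Prg.drop r0 (ms (x.code ++ r)) r0 (ms r) n := by
  have h₁ := exec_moveTop (i := .a) (S := ms (x.code ++ r)) x r (by simp) (by simp) rfl rfl rfl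
  simp only [update_ws_main, update_ws_a, ws_a] at h₁
  have h₂ := exec_clear (i := .a) (S := ws r (x.code.reverse ++ []) [] [] []) rfl
  simp only [update_ws_a, ws_a] at h₂
  refine ⟨_, ?_, Run.seq h₁ h₂⟩
  simp only [List.append_nil, List.length_reverse, BTree.length_code]
  omega

theorem exec_dup : ∃ n ≤ 16 * x.size + 16,
    Exec Prg.dup r0 (ms (x.code ++ r)) r0 (ms (x.code ++ (x.code ++ r))) n := by
  have h₁ := exec_moveTop (i := .a) (S := ms (x.code ++ r)) x r (by simp) (by simp) rfl rfl rfl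
  simp only [update_ws_main, update_ws_a, ws_a] at h₁
  have h₂ := exec_unload₂ (l := x.code.reverse ++ []) (m := r) (b := [])
  have h₃ := exec_unload (i := .b) (j := .a) (by simp)
    (S := ws ((x.code.reverse ++ []).reverse ++ r) [] ((x.code.reverse ++ []).reverse ++ []) [] [])
    rfl
  simp only [update_ws_b, update_ws_a, ws_b, ws_a] at h₃
  have h₄ := exec_unload (i := .a) (j := .main) (by simp)
    (S := ws ((x.code.reverse ++ []).reverse ++ r)
      (((x.code.reverse ++ []).reverse ++ []).reverse ++ []) [] [] []) rfl
  simp only [update_ws_main, update_ws_a, ws_a, ws_main] at h₄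
  have h := Run.seq h₁ (Run.seq h₂ (Run.seq h₃ h₄))
  simp only [List.append_nil, List.reverse_reverse] at h
  refine ⟨_, ?_, h⟩
  simp only [List.length_reverse, BTree.length_code]
  omega

theorem exec_swap₂₃ : ∃ n ≤ 32 * (x.size + y.size + z.size) + 32,
    Exec Prg.swap₂₃ r0 (ms (x.code ++ (y.code ++ (z.code ++ r)))) r0
      (ms (x.code ++ (z.code ++ (y.code ++ r)))) n := by
  have h₁ := exec_moveTop (i := .a) (S := ms (x.code ++ (y.code ++ (z.code ++ r)))) x
    (y.code ++ (z.code ++ r)) (by simp) (by simp) rfl rfl rfl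
  simp only [update_ws_main, update_ws_a, ws_a, List.append_nil] at h₁
  have h₂ := exec_moveTop (i := .b) (S := ws (y.code ++ (z.code ++ r)) x.code.reverse [] [] []) y
    (z.code ++ r) (by simp) (by simp) rfl rfl rfl
  simp only [update_ws_main, update_ws_b, ws_b, List.append_nil] at h₂
  have h₃ := exec_moveTop (i := .c) (S := ws (z.code ++ r) x.code.reverse y.code.reverse [] []) z r
    (by simp) (by simp) rfl rfl rfl
  simp only [update_ws_main, update_ws_c, ws_c, List.append_nil] at h₃
  have h₄ := exec_unload (i := .b) (j := .main) (by simp)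
    (S := ws r x.code.reverse y.code.reverse z.code.reverse []) rfl
  simp only [update_ws_main, update_ws_b, ws_b, ws_main, List.reverse_reverse] at h₄
  have h₅ := exec_unload (i := .c) (j := .main) (by simp)
    (S := ws (y.code ++ r) x.code.reverse [] z.code.reverse []) rfl
  simp only [update_ws_main, update_ws_c, ws_c, ws_main, List.reverse_reverse] at h₅
  have h₆ := exec_unload (i := .a) (j := .main) (by simp)
    (S := ws (z.code ++ (y.code ++ r)) x.code.reverse [] [] []) rfl
  simp only [update_ws_main, update_ws_a, ws_a, ws_main, List.reverse_reverse] at h₆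
  refine ⟨_, ?_, Run.seq h₁ (Run.seq h₂ (Run.seq h₃ (Run.seq h₄ (Run.seq h₅ h₆))))⟩
  simp only [List.length_reverse, BTree.length_code]
  omega

end trees

end exec

/-! ### Encodings as trees and functions computable in polynomial time. -/

/-- Types whose elements are encoded as binary trees. -/
class Enc (α : Type) where
  enc : α → BTree


/-- The size of the encoding. -/
def sz {α : Type} [Enc α] (x : α) : ℕ := (Enc.enc x).size

theorem one_le_sz {α : Type} [Enc α] (x : α) : 1 ≤ sz x := BTree.one_le_size _

instance : Enc BTree := ⟨id⟩

instance : Enc Bool := ⟨fun b => bif b then .node .nil .nil else .nil⟩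

instance {α β : Type} [Enc α] [Enc β] : Enc (α × β) := ⟨fun x => .node (Enc.enc x.1) (Enc.enc x.2)⟩

/-- The encoding of lists. -/
def encList {α : Type} [Enc α] : List α → BTree
  | [] => .nil
  | x :: l => .node (Enc.enc x) (encList l)

instance {α : Type} [Enc α] : Enc (List α) := ⟨encList⟩

section sizes
variable {α β : Type} [Enc α] [Enc β]

@[simp] theorem enc_nil : Enc.enc ([] : List α) = .nil := rfl
@[simp] theorem enc_cons (x : α) (l : List α) :
    Enc.enc (x :: l) = .node (Enc.enc x) (Enc.enc l) := rfl
@[simp] theorem enc_mk (x : α) (y : β) : Enc.enc (x, y) = .node (Enc.enc x) (Enc.enc y) := rfl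
@[simp] theorem sz_mk (x : α) (y : β) : sz (x, y) = sz x + sz y + 1 := rfl
@[simp] theorem sz_nil : sz ([] : List α) = 1 := rfl
@[simp] theorem sz_cons (x : α) (l : List α) : sz (x :: l) = sz x + sz l + 1 := rfl

theorem sz_bool_le (b : Bool) : sz b ≤ 3 := by cases b <;> decide

theorem length_le_sz (l : List α) : l.length ≤ sz l := by
  induction l with
  | nil => simp
  | cons x l ih => simp; omega

theorem sz_append (l l' : List α) : sz (l ++ l') + 1 = sz l + sz l' := by
  induction l with
  | nil => simp [add_comm]
  | cons x l ih => simp; omega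

theorem sz_reverse (l : List α) : sz l.reverse = sz l := by
  induction l with
  | nil => rfl
  | cons x l ih => have := sz_append l.reverse [x]; simp at this ⊢; omega

theorem sz_le_of_mem {x : α} {l : List α} (h : x ∈ l) : sz x ≤ sz l := by
  induction l with
  | nil => simp at h
  | cons y l ih =>
    rcases List.mem_cons.1 h with rfl | h
    · simp; omega
    · have := ih h; simp; omega

theorem sz_le_of_prefix {l l' : List α} (h : l' <+: l) : sz l' ≤ sz l := by
  obtain ⟨m, rfl⟩ := h
  have := sz_append l' m
  have := one_le_sz m
  omega

theorem sz_le_of_suffix {l l' : List α} (h : l' <:+ l) : sz l' ≤ sz l := by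
  obtain ⟨m, rfl⟩ := h
  have := sz_append m l'
  have := one_le_sz m
  omega

theorem sz_le_length_mul {l : List α} {c : ℕ} (h : ∀ x ∈ l, sz x ≤ c) :
    sz l ≤ l.length * (c + 1) + 1 := by
  induction l with
  | nil => simp
  | cons x l ih =>
    have h₁ := h x (by simp)
    have h₂ := ih fun y hy => h y (by simp [hy])
    simp only [sz_cons, List.length_cons]
    nlinarith

end sizes

/-- Natural coefficients make every bound monotone, so a size may always be replaced by an upper
bound. -/
theorem eval_mono (q : Polynomial ℕ) {a b : ℕ} (h : a ≤ b) : q.eval a ≤ q.eval b := by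
  simp only [Polynomial.eval_eq_sum, Polynomial.sum]
  gcongr

/-- `f` is computed in polynomial time, on encodings as binary trees. -/
def PolyTime {α β : Type} [Enc α] [Enc β] (f : α → β) : Prop :=
  ∃ (p : Prg) (q : Polynomial ℕ), ∀ x, sz (f x) ≤ q.eval (sz x) ∧
    ∀ r, ∃ n ≤ q.eval (sz x),
      Exec p r0 (ms ((Enc.enc x).code ++ r)) r0 (ms ((Enc.enc (f x)).code ++ r)) n

namespace PolyTime
variable {α β γ δ : Type} [Enc α] [Enc β] [Enc γ] [Enc δ]

theorem exists_sz_le {f : α → β} (hf : PolyTime f) : ∃ q : Polynomial ℕ, ∀ x, sz (f x) ≤ q.eval (sz x) :=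
  let ⟨_, q, h⟩ := hf
  ⟨q, fun x => (h x).1⟩

/-- Functions that agree on encodings are computed by the same programs. -/
theorem of_enc_eq {f : α → β} {g : γ → δ} (hf : PolyTime f) (e : γ → α)
    (he : ∀ x, Enc.enc (e x) = Enc.enc x) (hg : ∀ x, Enc.enc (f (e x)) = Enc.enc (g x)) :
    PolyTime g := by
  obtain ⟨p, q, h⟩ := hf
  refine ⟨p, q, fun x => ?_⟩
  have hx := h (e x)
  unfold sz at hx ⊢
  rw [he, hg] at hx
  exact hx

theorem comp {f : β → γ} {g : α → β} (hf : PolyTime f) (hg : PolyTime g) :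
    PolyTime fun x => f (g x) := by
  obtain ⟨p, q, hp⟩ := hf
  obtain ⟨p', q', hp'⟩ := hg
  refine ⟨.seq p' p, q' + q.comp q', fun x => ?_⟩
  obtain ⟨h₁, h₂⟩ := hp' x
  obtain ⟨h₃, h₄⟩ := hp (g x)
  have h₅ := eval_mono q h₁
  simp only [Polynomial.eval_add, Polynomial.eval_comp]
  refine ⟨by omega, fun r => ?_⟩
  obtain ⟨n, hn, h⟩ := h₂ r
  obtain ⟨m, hm, h'⟩ := h₄ r
  exact ⟨n + m, by omega, .seq h h'⟩

theorem of_eq {f g : α → β} (hf : PolyTime f) (h : ∀ x, f x = g x) : PolyTime g :=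
  (funext h : f = g) ▸ hf

theorem id : PolyTime fun x : α => x :=
  ⟨Prg.reset, .X + 1, fun x => ⟨by simp, fun r => ⟨1, by simp, exec_reset⟩⟩⟩

/-- Functions that do not change the encoding are computed in polynomial time. -/
theorem of_enc {f : α → β} (h : ∀ x, Enc.enc (f x) = Enc.enc x) : PolyTime f :=
  (id (α := α)).of_enc_eq _ (fun _ => rfl) fun x => (h x).symm

end PolyTime

/-- Push the code of a tree. -/
def Prg.pushList : List Bool → Prg
  | [] => Prg.reset
  | b :: l => .seq (Prg.pushList l) (Prg.pushC .main b)

theorem exec_pushList (l r : List Bool) (v : Reg) (I : List Letter) :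
    ExecI (Prg.pushList l) v I (ms r) r0 I (ms (l ++ r)) (l.length + 1) := by
  induction l with
  | nil => exact exec_reset
  | cons b l ih =>
    have h := exec_pushC (i := .main) (v := r0) (I := I) (b := b) (S := ms (l ++ r))
    simp only [update_ws_main, ws_main] at h
    exact .seq ih h

namespace PolyTime
variable {α β γ δ : Type} [Enc α] [Enc β] [Enc γ] [Enc δ]

theorem const (c : β) : PolyTime fun _ : α => c := by
  refine ⟨.seq Prg.drop (Prg.pushList (Enc.enc c).code), 8 * .X + (8 + sz c + 1 : ℕ),
    fun x => ⟨by simp; omega, fun r => ?_⟩⟩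
  obtain ⟨n, hn, h⟩ := exec_drop (Enc.enc x) r
  refine ⟨_, ?_, .seq h (exec_pushList _ r _ _)⟩
  simp [sz] at hn ⊢
  omega

/-- The argument is duplicated, `g` runs on the upper copy, and `f` runs on the other after an
exchange. The final `true` is the node bit that joins the two codes. -/
theorem pair {f : α → β} {g : α → γ} (hf : PolyTime f) (hg : PolyTime g) :
    PolyTime fun x => (f x, g x) := by
  obtain ⟨p, q, hp⟩ := hf
  obtain ⟨p', q', hp'⟩ := hg
  refine ⟨.seq Prg.dup (.seq p' (.seq Prg.swap (.seq p (Prg.pushC .main true)))),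
    q + 17 * q' + 32 * .X + 33, fun x => ?_⟩
  obtain ⟨h₁, h₂⟩ := hp' x
  obtain ⟨h₃, h₄⟩ := hp x
  simp only [Polynomial.eval_add, Polynomial.eval_mul, Polynomial.eval_ofNat, Polynomial.eval_X]
  refine ⟨by simp; omega, fun r => ?_⟩
  obtain ⟨n₁, hn₁, e₁⟩ := exec_dup (Enc.enc x) r
  obtain ⟨n₂, hn₂, e₂⟩ := h₂ ((Enc.enc x).code ++ r)
  obtain ⟨n₃, hn₃, e₃⟩ := exec_swap (Enc.enc (g x)) (Enc.enc x) r
  obtain ⟨n₄, hn₄, e₄⟩ := h₄ ((Enc.enc (g x)).code ++ r)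
  have e₅ := exec_pushC (i := .main) (v := r0) (I := []) (b := true)
    (S := ms ((Enc.enc (f x)).code ++ ((Enc.enc (g x)).code ++ r)))
  simp only [update_ws_main, ws_main] at e₅
  refine ⟨n₁ + (n₂ + (n₃ + (n₄ + 1))), ?_, ?_⟩
  · unfold sz at *; omega
  · simpa [BTree.code] using Run.seq e₁ (.seq e₂ (.seq e₃ (.seq e₄ e₅)))

theorem exec_popToken (b : Bool) (v : Reg) (r : List Bool) :
    Exec (Prg.popX .main) v (ms (b :: r)) (some b, v.2) (ms r) 1 := by
  have h := exec_popX (i := .main) (v := v) (I := []) (S := ms (b :: r))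
  simpa using h

theorem fst : PolyTime fun x : α × β => x.1 := by
  refine ⟨.seq (Prg.popX .main) (.seq Prg.reset (.seq Prg.swap Prg.drop)), 24 * .X + 50,
    fun x => ⟨by simp only [Polynomial.eval_add, Polynomial.eval_mul, Polynomial.eval_ofNat,
      Polynomial.eval_X]; rcases x with ⟨x, y⟩; simp; omega, fun r => ?_⟩⟩
  rcases x with ⟨x, y⟩
  obtain ⟨n₁, hn₁, e₁⟩ := exec_swap (Enc.enc x) (Enc.enc y) r
  obtain ⟨n₂, hn₂, e₂⟩ := exec_drop (Enc.enc y) ((Enc.enc x).code ++ r)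
  refine ⟨1 + (1 + (n₁ + n₂)), ?_, ?_⟩
  · simp [sz, BTree.size] at *; omega
  · have := Run.seq (exec_popToken true r0 _) (.seq exec_reset (.seq e₁ e₂))
    simpa [BTree.code] using this

theorem snd : PolyTime fun x : α × β => x.2 := by
  refine ⟨.seq (Prg.popX .main) (.seq Prg.reset Prg.drop), 24 * .X + 50,
    fun x => ⟨by simp only [Polynomial.eval_add, Polynomial.eval_mul, Polynomial.eval_ofNat,
      Polynomial.eval_X]; rcases x with ⟨x, y⟩; simp; omega, fun r => ?_⟩⟩
  rcases x with ⟨x, y⟩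
  obtain ⟨n₂, hn₂, e₂⟩ := exec_drop (Enc.enc x) ((Enc.enc y).code ++ r)
  refine ⟨1 + (1 + n₂), ?_, ?_⟩
  · simp [sz, BTree.size] at *; omega
  · have := Run.seq (exec_popToken true r0 _) (.seq exec_reset e₂)
    simpa [BTree.code] using this

theorem ite {c : α → Bool} {f g : α → β} (hc : PolyTime c) (hf : PolyTime f) (hg : PolyTime g) :
    PolyTime fun x => if c x then f x else g x := by
  obtain ⟨p₀, q₀, hp₀⟩ := hc
  obtain ⟨p, q, hp⟩ := hf
  obtain ⟨p', q', hp'⟩ := hg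
  -- The truth value `true` is coded by a node with two leaves, hence the two additional pops in its
  -- branch.
  refine ⟨.seq Prg.dup (.seq p₀ (.seq (Prg.popX .main) (.ite (fun v => v.1 == some true)
      (.seq (Prg.popX .main) (.seq (Prg.popX .main) (.seq Prg.reset p))) (.seq Prg.reset p')))),
    q₀ + q + q' + 16 * .X + 30, fun x => ?_⟩
  obtain ⟨-, h₂⟩ := hp₀ x
  obtain ⟨h₃, h₄⟩ := hp x
  obtain ⟨h₅, h₆⟩ := hp' x
  simp only [Polynomial.eval_add, Polynomial.eval_mul, Polynomial.eval_ofNat, Polynomial.eval_X]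
  refine ⟨by split_ifs <;> omega, fun r => ?_⟩
  obtain ⟨n₁, hn₁, e₁⟩ := exec_dup (Enc.enc x) r
  obtain ⟨n₂, hn₂, e₂⟩ := h₂ ((Enc.enc x).code ++ r)
  change n₁ ≤ 16 * sz x + 16 at hn₁
  cases hcx : c x with
  | true =>
    obtain ⟨n₃, hn₃, e₃⟩ := h₄ r
    rw [hcx] at e₂
    refine ⟨n₁ + (n₂ + (1 + ((1 + (1 + (1 + n₃))) + 1))), by omega, ?_⟩
    exact .seq e₁ (.seq e₂ (.seq (exec_popToken true r0 _) (.iteTrue rfl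
      (.seq (exec_popToken false _ _) (.seq (exec_popToken false _ _) (.seq exec_reset e₃))))))
  | false =>
    obtain ⟨n₃, hn₃, e₃⟩ := h₆ r
    rw [hcx] at e₂
    refine ⟨n₁ + (n₂ + (1 + ((1 + n₃) + 1))), by omega, ?_⟩
    exact .seq e₁ (.seq e₂ (.seq (exec_popToken false r0 _) (.iteFalse rfl (.seq exec_reset e₃))))

theorem cons {f : α → β} {g : α → List β} (hf : PolyTime f) (hg : PolyTime g) :
    PolyTime fun x => f x :: g x :=
  (of_enc (f := fun x : β × List β => x.1 :: x.2) fun _ => rfl).comp (hf.pair hg)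

/-- Case distinction on a list. -/
theorem listCases_aux {g : α → γ} {k : β × List β × α → γ} (hg : PolyTime g) (hk : PolyTime k) :
    PolyTime fun x : List β × α => x.1.casesOn (motive := fun _ => γ) (g x.2)
      fun h t => k (h, t, x.2) := by
  obtain ⟨p, q, hp⟩ := hg
  obtain ⟨p', q', hp'⟩ := hk
  -- The codes of `(h :: t, y)` and `(h, t, y)` differ only in the place of the second node bit,
  -- which has to move behind the code of `h`.
  refine ⟨.seq (Prg.popX .main) (.seq (Prg.popX .main) (.ite (fun v => v.1 == some true)
      (.seq Prg.reset (.seq (Prg.moveTop .a) (.seq (Prg.pushC .main true)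
        (.seq (Prg.unload .a .main) (.seq (Prg.pushC .main true) p'))))) (.seq Prg.reset p))),
    q + q' + 8 * .X + 30, fun x => ?_⟩
  simp only [Polynomial.eval_add, Polynomial.eval_mul, Polynomial.eval_ofNat, Polynomial.eval_X]
  rcases x with ⟨_ | ⟨h, t⟩, y⟩
  · obtain ⟨h₁, h₂⟩ := hp y
    have h₃ := eval_mono q (show sz y ≤ sz (([] : List β), y) by simp; omega)
    refine ⟨by simp only; omega, fun r => ?_⟩
    obtain ⟨n, hn, e⟩ := h₂ r
    refine ⟨1 + (1 + ((1 + n) + 1)), by omega, ?_⟩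
    exact .seq (exec_popToken true r0 _) (.seq (exec_popToken false _ _)
      (.iteFalse rfl (.seq exec_reset e)))
  · obtain ⟨h₁, h₂⟩ := hp' (h, t, y)
    have h₃ := eval_mono q' (show sz (h, t, y) ≤ sz (h :: t, y) by simp; omega)
    refine ⟨by simp only; omega, fun r => ?_⟩
    obtain ⟨n, hn, e⟩ := h₂ r
    have e₁ := exec_moveTop (i := .a)
      (S := ms ((Enc.enc h).code ++ ((Enc.enc t).code ++ ((Enc.enc y).code ++ r))))
      (Enc.enc h) _ (by simp) (by simp) rfl rfl rfl
    simp only [update_ws_main, update_ws_a, ws_a, List.append_nil] at e₁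
    have e₂ := exec_pushC (i := .main) (v := r0) (I := []) (b := true)
      (S := ws ((Enc.enc t).code ++ ((Enc.enc y).code ++ r)) (Enc.enc h).code.reverse [] [] [])
    simp only [update_ws_main, ws_main] at e₂
    have e₃ := exec_unload (i := .a) (j := .main) (by simp)
      (S := ws (true :: ((Enc.enc t).code ++ ((Enc.enc y).code ++ r))) (Enc.enc h).code.reverse
        [] [] []) rfl
    simp only [update_ws_main, update_ws_a, ws_a, ws_main, List.reverse_reverse] at e₃
    have e₄ := exec_pushC (i := .main) (v := r0) (I := []) (b := true)
      (S := ms ((Enc.enc h).code ++ true :: ((Enc.enc t).code ++ ((Enc.enc y).code ++ r))))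
    simp only [update_ws_main, ws_main] at e₄
    have e' : (Enc.enc (h, t, y)).code ++ r =
      true :: ((Enc.enc h).code ++ true :: ((Enc.enc t).code ++ ((Enc.enc y).code ++ r))) := by
      simp [BTree.code]
    rw [e'] at e
    have e₅ := Run.seq (exec_popToken true r0 _) (.seq (exec_popToken true _ _)
      (.iteTrue (c := fun v : Reg => v.1 == some true) (q := .seq Prg.reset p) rfl
        (.seq exec_reset (.seq e₁ (.seq e₂ (.seq e₃ (.seq e₄ e)))))))
    refine ⟨_, ?_, by simpa [BTree.code] using e₅⟩
    simp only [sz, List.length_reverse, BTree.length_code, enc_mk, enc_cons, BTree.size] at *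
    omega

theorem listCases {l : α → List β} {g : α → γ} {k : β × List β × α → γ} (hl : PolyTime l)
    (hg : PolyTime g) (hk : PolyTime k) :
    PolyTime fun x => (l x).casesOn (motive := fun _ => γ) (g x) fun h t => k (h, t, x) :=
  (listCases_aux hg hk).comp (hl.pair id)

end PolyTime

namespace Prg

/-- The loop that folds a list, given a program for the step function. -/
def foldLoop (p : Prg) : Prg :=
  .loop (fun v => v.1 == some true) (.seq reset (.seq swap₂₃ (.seq (pushC .main true)
    (.seq p (.seq swap (popX .main))))))

/-- The loop that compares the content of two stacks. -/
def compareLoop : Prg :=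
  .loop (fun v => v.1 == v.2.1 && v.1.isSome) (.seq (popX .a) (popY .b))

/-- Compare the two topmost trees. -/
def eqTest : Prg :=
  .seq (moveTop .a) (.seq (moveTop .b) (.seq (popX .a) (.seq (popY .b) (.seq compareLoop
    (.seq (.ite (fun v => v.1 == none && v.2.1 == none)
      (.seq (pushC .main false) (.seq (pushC .main false) (pushC .main true)))
      (pushC .main false)) (.seq reset (.seq (clear .a) (clear .b))))))))

end Prg

/-- The loop pops both stacks in parallel as long as the two registers hold the same bit, so both
end up empty exactly if the lists agree. The length bounds on what remains control the cost of
clearing it. -/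
theorem exec_compareLoop (la lb m : List Bool) : ∃ n ≤ 3 * la.length + 1, ∃ v' : Reg,
    ∃ la' lb' : List Bool, la'.length ≤ la.length ∧ lb'.length ≤ lb.length ∧
      ((v'.1 == none && v'.2.1 == none) = decide (la = lb)) ∧
      Exec Prg.compareLoop (la.head?, lb.head?, none) (ws m la.tail lb.tail [] []) v'
        (ws m la' lb' [] []) n := by
  induction la generalizing lb with
  | nil =>
    refine ⟨1, by simp, _, _, _, le_rfl, ?_, ?_, Run.loopFalse (by simp)⟩
    · simp
    · cases lb <;> simp
  | cons x la ih =>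
    by_cases hx : lb.head? = some x
    · obtain ⟨lb, rfl⟩ : ∃ l, lb = x :: l := by
        cases lb with
        | nil => simp at hx
        | cons y l => simp at hx; exact ⟨l, by rw [hx]⟩
      obtain ⟨n, hn, v', la', lb', h₁, h₂, h₃, h⟩ := ih lb
      have e₁ := exec_popX (i := .a) (v := (some x, some x, none)) (I := []) (S := ws m la lb [] [])
      have e₂ := exec_popY (i := .b) (v := (la.head?, some x, none)) (I := [])
        (S := ws m la.tail lb [] [])
      simp only [update_ws_a, update_ws_b, ws_a, ws_b] at e₁ e₂
      refine ⟨1 + 1 + 1 + n, by simp; omega, v', la', lb', by simp; omega, by simp; omega,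
        by rw [h₃]; simp, ?_⟩
      exact Run.loopTrue (by simp) (.seq e₁ e₂) h
    · refine ⟨1, by simp, _, _, _, by simp, by simp, ?_, Run.loopFalse ?_⟩
      · rcases lb with _ | ⟨y, l⟩
        · simp
        · simp at hx ⊢
          exact fun h => absurd h.symm hx
      · rcases lb with _ | ⟨y, l⟩
        · simp
        · simp at hx ⊢
          exact fun h => hx h.symm

theorem exec_eqTest (x y : BTree) (r : List Bool) [Decidable (x = y)] :
    ∃ n ≤ 20 * (x.size + y.size) + 40, Exec Prg.eqTest r0 (ms (x.code ++ (y.code ++ r))) r0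
      (ms ((Enc.enc (decide (x = y))).code ++ r)) n := by
  have h₁ := exec_moveTop (i := .a) (S := ms (x.code ++ (y.code ++ r))) x (y.code ++ r) (by simp)
    (by simp) rfl rfl rfl
  simp only [update_ws_main, update_ws_a, ws_a, List.append_nil] at h₁
  have h₂ := exec_moveTop (i := .b) (S := ws (y.code ++ r) x.code.reverse [] [] []) y r
    (by simp) (by simp) rfl rfl rfl
  simp only [update_ws_main, update_ws_b, ws_b, List.append_nil] at h₂
  have h₃ := exec_popX (i := .a) (v := r0) (I := [])
    (S := ws r x.code.reverse y.code.reverse [] [])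
  have h₄ := exec_popY (i := .b) (v := (x.code.reverse.head?, none, none)) (I := [])
    (S := ws r x.code.reverse.tail y.code.reverse [] [])
  simp only [update_ws_a, update_ws_b, ws_a, ws_b] at h₃ h₄
  obtain ⟨n, hn, v', la, lb, hla, hlb, hv, h₅⟩ := exec_compareLoop x.code.reverse y.code.reverse r
  have hxy : (x.code.reverse = y.code.reverse) ↔ x = y := by
    rw [List.reverse_inj, BTree.code_injective.eq_iff]
  replace hv : _ = decide (x = y) := hv.trans (decide_eq_decide.2 hxy)
  have h₆ : ∃ m ≤ 4, Exec (.ite (fun v => v.1 == none && v.2.1 == none)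
      (.seq (Prg.pushC .main false) (.seq (Prg.pushC .main false) (Prg.pushC .main true)))
      (Prg.pushC .main false)) v' (ws r la lb [] []) v'
      (ws ((Enc.enc (decide (x = y))).code ++ r) la lb [] []) m := by
    by_cases h : x = y
    · have e₁ := exec_pushC (i := .main) (v := v') (I := []) (b := false) (S := ws r la lb [] [])
      have e₂ := exec_pushC (i := .main) (v := v') (I := []) (b := false)
        (S := ws (false :: r) la lb [] [])
      have e₃ := exec_pushC (i := .main) (v := v') (I := []) (b := true)
        (S := ws (false :: false :: r) la lb [] [])
      simp only [update_ws_main, ws_main] at e₁ e₂ e₃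
      refine ⟨1 + (1 + 1) + 1, by simp, Run.iteTrue (hv.trans (decide_eq_true h)) ?_⟩
      simpa [h, Enc.enc, BTree.code] using Run.seq e₁ (.seq e₂ e₃)
    · have e₁ := exec_pushC (i := .main) (v := v') (I := []) (b := false) (S := ws r la lb [] [])
      simp only [update_ws_main, ws_main] at e₁
      refine ⟨1 + 1, by simp, Run.iteFalse (hv.trans (decide_eq_false h)) ?_⟩
      simpa [h, Enc.enc, BTree.code] using e₁
  obtain ⟨m, hm, h₆⟩ := h₆
  have h₇ := exec_clear (i := .a)
    (S := ws ((Enc.enc (decide (x = y))).code ++ r) la lb [] []) rfl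
  have h₈ := exec_clear (i := .b)
    (S := ws ((Enc.enc (decide (x = y))).code ++ r) [] lb [] []) rfl
  simp only [update_ws_a, update_ws_b, ws_a, ws_b] at h₇ h₈
  refine ⟨_, ?_, .seq h₁ (.seq h₂ (.seq h₃ (.seq h₄ (.seq h₅ (.seq h₆ (.seq exec_reset
    (.seq h₇ h₈)))))))⟩
  simp only [List.length_reverse, BTree.length_code] at *
  omega

namespace PolyTime
variable {α β γ σ : Type} [Enc α] [Enc β] [Enc γ] [Enc σ]

theorem enc_eq {f : α → β} {g : α → γ} [∀ x, Decidable (Enc.enc (f x) = Enc.enc (g x))]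
    (hf : PolyTime f) (hg : PolyTime g) :
    PolyTime fun x => decide (Enc.enc (f x) = Enc.enc (g x)) := by
  classical
  have h : PolyTime fun x : β × γ => decide (Enc.enc x.1 = Enc.enc x.2) := by
    refine ⟨.seq (Prg.popX .main) (.seq Prg.reset Prg.eqTest), 20 * .X + 50, fun x =>
      ⟨?_, fun r => ?_⟩⟩
    · have := sz_bool_le (decide (Enc.enc x.1 = Enc.enc x.2))
      simp; omega
    · rcases x with ⟨x, y⟩
      obtain ⟨n, hn, e⟩ := exec_eqTest (Enc.enc x) (Enc.enc y) r
      refine ⟨1 + (1 + n), ?_, ?_⟩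
      · simp [sz, BTree.size] at *; omega
      · have := Run.seq (exec_popToken true r0 _) (.seq exec_reset e)
        simpa [BTree.code] using this
  refine (h.comp (hf.pair hg)).of_eq fun x => ?_
  congr

/-- The bit in the register tells whether an element remains. The list lies above the accumulator,
and each round brings its head and the accumulator together as a pair. Since `B` bounds all
accumulators, every round has the same cost bound. -/
theorem exec_foldLoop {p : Prg} {q : Polynomial ℕ} {f : β × σ → σ}
    (hp : ∀ x, ∀ r, ∃ n ≤ q.eval (sz x),
      Exec p r0 (ms ((Enc.enc x).code ++ r)) r0 (ms ((Enc.enc (f x)).code ++ r)) n) (N B : ℕ)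
    (l : List β) (s : σ) (hl : sz l ≤ N)
    (hs : ∀ l', l' <+: l → sz (l'.foldl (fun s b => f (b, s)) s) ≤ B) (r : List Bool) :
    ∃ n ≤ l.length * (64 * (N + B) + q.eval (N + B + 1) + 60) + 1,
      Exec (Prg.foldLoop p) ((Enc.enc l).code.head?, none, none)
        (ms ((Enc.enc l).code.tail ++ ((Enc.enc s).code ++ r))) (some false, none, none)
        (ms ((Enc.enc (l.foldl (fun s b => f (b, s)) s)).code ++ r)) n := by
  induction l generalizing s with
  | nil => exact ⟨1, by simp, Run.loopFalse rfl⟩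
  | cons h t ih =>
    simp only [sz_cons] at hl
    obtain ⟨n, hn, e⟩ := ih (f (h, s)) (by omega) fun l' hl' =>
      hs (h :: l') (List.cons_prefix_cons.2 ⟨rfl, hl'⟩)
    have hs₀ : sz s ≤ B := hs [] (List.nil_prefix)
    have hs₁ : sz (f (h, s)) ≤ B := hs [h] (by simp)
    obtain ⟨n₁, hn₁, e₁⟩ := exec_swap₂₃ (Enc.enc h) (Enc.enc t) (Enc.enc s) r
    have e₂ := exec_pushC (i := .main) (v := r0) (I := []) (b := true)
      (S := ms ((Enc.enc h).code ++ ((Enc.enc s).code ++ ((Enc.enc t).code ++ r))))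
    simp only [update_ws_main, ws_main] at e₂
    obtain ⟨n₃, hn₃, e₃⟩ := hp (h, s) ((Enc.enc t).code ++ r)
    obtain ⟨n₄, hn₄, e₄⟩ := exec_swap (Enc.enc (f (h, s))) (Enc.enc t) r
    have e₅ := exec_popX (i := .main) (v := r0) (I := [])
      (S := ms ((Enc.enc t).code ++ ((Enc.enc (f (h, s))).code ++ r)))
    have hne : (Enc.enc t).code ≠ [] := by
      rw [← List.length_pos_iff, BTree.length_code]
      exact BTree.one_le_size _
    simp only [update_ws_main, ws_main, List.tail_append_of_ne_nil hne,
      List.head?_append_of_ne_nil _ hne] at e₅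
    have e₃' : Exec p r0 (ms (true :: ((Enc.enc h).code ++ ((Enc.enc s).code ++
        ((Enc.enc t).code ++ r))))) r0
        (ms ((Enc.enc (f (h, s))).code ++ ((Enc.enc t).code ++ r))) n₃ := by
      simpa [BTree.code] using e₃
    have e₆ := Run.loopTrue (c := fun v : Reg => v.1 == some true)
      (v := (some true, none, none)) rfl
      (.seq exec_reset (.seq e₁ (.seq e₂ (.seq e₃' (.seq e₄ e₅))))) e
    refine ⟨_, ?_, by simpa [BTree.code, Prg.foldLoop] using e₆⟩
    have := eval_mono q (show sz (h, s) ≤ N + B + 1 by simp; omega)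
    simp only [sz] at *
    rw [List.length_cons, Nat.succ_mul]
    omega

/-- Folding a list, if the intermediate results are of polynomial size. -/
theorem foldl_aux {l : α → List β} {s₀ : α → σ} {f : β × σ → σ} (hl : PolyTime l)
    (hs : PolyTime s₀) (hf : PolyTime f) (q : Polynomial ℕ)
    -- Iterating a polynomial-time step can blow up sizes exponentially; bounding the result on
    -- every prefix excludes this.
    (hq : ∀ x l', l' <+: l x → sz (l'.foldl (fun s b => f (b, s)) (s₀ x)) ≤ q.eval (sz x)) :
    PolyTime fun x => (l x).foldl (fun s b => f (b, s)) (s₀ x) := by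
  obtain ⟨ql, hql⟩ := hl.exists_sz_le
  obtain ⟨p, q₀, hp⟩ := hl.pair hs
  obtain ⟨p', q', hp'⟩ := hf
  refine ⟨.seq p (.seq (Prg.popX .main) (.seq (Prg.popX .main) (.seq (Prg.foldLoop p') Prg.reset))),
    q + (q₀ + ql * (64 * (ql + q) + q'.comp (ql + q + 1) + 60) + 10), fun x => ?_⟩
  have hx := hq x _ List.prefix_rfl
  simp only [Polynomial.eval_add, Polynomial.eval_mul, Polynomial.eval_ofNat, Polynomial.eval_comp,
    Polynomial.eval_one]
  refine ⟨by omega, fun r => ?_⟩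
  obtain ⟨n₁, hn₁, e₁⟩ := (hp x).2 r
  obtain ⟨n₂, hn₂, e₂⟩ := exec_foldLoop (fun x => (hp' x).2) (ql.eval (sz x)) (q.eval (sz x))
    (l x) (s₀ x) (hql x) (hq x) r
  have hne : (Enc.enc (l x)).code ≠ [] := by
    rw [← List.length_pos_iff, BTree.length_code]
    exact BTree.one_le_size _
  have e₃ := exec_popX (i := .main) (v := (some true, none, none)) (I := [])
    (S := ms ((Enc.enc (l x)).code ++ ((Enc.enc (s₀ x)).code ++ r)))
  simp only [update_ws_main, ws_main, List.tail_append_of_ne_nil hne,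
    List.head?_append_of_ne_nil _ hne] at e₃
  have e₁' : Exec p r0 (ms ((Enc.enc x).code ++ r)) r0
      (ms (true :: ((Enc.enc (l x)).code ++ ((Enc.enc (s₀ x)).code ++ r)))) n₁ := by
    simpa [BTree.code] using e₁
  refine ⟨_, ?_, .seq e₁' (.seq (exec_popToken true r0 _) (.seq e₃ (.seq e₂ exec_reset)))⟩
  have h₁ : (l x).length ≤ ql.eval (sz x) := (length_le_sz _).trans (hql x)
  have h₂ := Nat.mul_le_mul_right (64 * (ql.eval (sz x) + q.eval (sz x)) +
    q'.eval (ql.eval (sz x) + q.eval (sz x) + 1) + 60) h₁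
  omega

/-- Folding a list with parameters, if the intermediate results are of polynomial size. -/
theorem foldl {l : α → List β} {s₀ : α → σ} {f : α × β × σ → σ} (hl : PolyTime l)
    (hs : PolyTime s₀) (hf : PolyTime f) (q : Polynomial ℕ)
    (hq : ∀ x l', l' <+: l x → sz (l'.foldl (fun s b => f (x, b, s)) (s₀ x)) ≤ q.eval (sz x)) :
    PolyTime fun x => (l x).foldl (fun s b => f (x, b, s)) (s₀ x) := by
  -- The parameter `x` is carried along inside the accumulator.
  have key : ∀ x (l' : List β) s, l'.foldl
      (fun (s : α × σ) b => (fun y : β × α × σ => (y.2.1, f (y.2.1, y.1, y.2.2))) (b, s)) (x, s) =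
      (x, l'.foldl (fun s b => f (x, b, s)) s) := by
    intro x l'
    induction l' with
    | nil => exact fun s => rfl
    | cons b l' ih => exact fun s => ih _
  have h := foldl_aux hl (id.pair hs)
    (f := fun y : β × α × σ => (y.2.1, f (y.2.1, y.1, y.2.2)))
    ((fst.comp snd).pair (hf.comp ((fst.comp snd).pair (fst.pair (snd.comp snd)))))
    (q + .X + 1) (by
      intro x l' hl'
      rw [key]
      have := hq x l' hl'
      simp
      omega)
  refine (snd.comp h).of_eq fun x => ?_
  rw [key]

end PolyTime

/-! ### Equality tests and list operations in polynomial time. -/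

/-- Encodings that are injective. -/
class LawfulEnc (α : Type) [Enc α] : Prop where
  inj : Function.Injective (Enc.enc : α → BTree)

instance : LawfulEnc BTree := ⟨fun _ _ h => h⟩

instance : LawfulEnc Bool := ⟨fun a b h => by cases a <;> cases b <;> simp_all [Enc.enc]⟩

instance {α β : Type} [Enc α] [Enc β] [LawfulEnc α] [LawfulEnc β] : LawfulEnc (α × β) :=
  ⟨fun a b h => by
    rcases a with ⟨a, a'⟩
    rcases b with ⟨b, b'⟩
    simp only [enc_mk, BTree.node.injEq] at h
    rw [LawfulEnc.inj h.1, LawfulEnc.inj h.2]⟩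

instance {α : Type} [Enc α] [LawfulEnc α] : LawfulEnc (List α) :=
  ⟨fun l => by
    induction l with
    | nil => intro l' h; cases l' <;> simp_all
    | cons x l ih =>
      intro l' h
      cases l' with
      | nil => simp at h
      | cons y l' =>
        simp only [enc_cons, BTree.node.injEq] at h
        rw [LawfulEnc.inj h.1, ih h.2]⟩

/-- `allRel r us vs` holds if `us` and an initial part of `vs` are related elementwise by `r`. -/
def allRel {β : Type} (r : β → β → Bool) : List β → List β → Bool
  | [], _ => true
  | _ :: _, [] => false
  | u :: us, v :: vs => r u v && allRel r us vs

theorem allRel_ofFn {β : Type} {r : β → β → Bool} {n : ℕ} {f g : Fin n → β} :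
    allRel r (List.ofFn f) (List.ofFn g) = true ↔ ∀ i, r (f i) (g i) = true := by
  induction n with
  | zero => simp [allRel]
  | succ n ih => simp [List.ofFn_succ, allRel, ih, Fin.forall_fin_succ]

namespace PolyTime
variable {α β γ δ : Type} [Enc α] [Enc β] [Enc γ] [Enc δ]

theorem eq [LawfulEnc β] {f g : α → β} [∀ x, Decidable (f x = g x)] (hf : PolyTime f)
    (hg : PolyTime g) : PolyTime fun x => decide (f x = g x) := by
  classical
  exact (hf.enc_eq hg).of_eq fun x => decide_eq_decide.2 LawfulEnc.inj.eq_iff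

theorem and {p q : α → Bool} (hp : PolyTime p) (hq : PolyTime q) : PolyTime fun x => p x && q x :=
  (hp.ite hq (const false)).of_eq fun x => by cases p x <;> simp

theorem or {p q : α → Bool} (hp : PolyTime p) (hq : PolyTime q) : PolyTime fun x => p x || q x :=
  (hp.ite (const true) hq).of_eq fun x => by cases p x <;> simp

theorem reverse {l : α → List β} (hl : PolyTime l) : PolyTime fun x => (l x).reverse := by
  obtain ⟨q, hq⟩ := hl.exists_sz_le
  have key : ∀ l s : List β, l.foldl (fun s b => b :: s) s = l.reverse ++ s := by
    intro l
    induction l with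
    | nil => simp
    | cons b l ih => intro s; simp [ih]
  have h := foldl (s₀ := fun _ : α => ([] : List β)) (f := fun y : α × β × List β => y.2.1 :: y.2.2)
    hl (const _) ((fst.comp snd).cons (snd.comp snd)) q (by
      intro x l' hl'
      rw [key, List.append_nil, sz_reverse]
      exact (sz_le_of_prefix hl').trans (hq x))
  exact h.of_eq fun x => by rw [key, List.append_nil]

theorem append {l l' : α → List β} (hl : PolyTime l) (hl' : PolyTime l') :
    PolyTime fun x => l x ++ l' x := by
  obtain ⟨q, hq⟩ := hl.exists_sz_le
  obtain ⟨q', hq'⟩ := hl'.exists_sz_le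
  have key : ∀ l s : List β, l.foldl (fun s b => b :: s) s = l.reverse ++ s := by
    intro l
    induction l with
    | nil => simp
    | cons b l ih => intro s; simp [ih]
  have h := foldl (f := fun y : α × β × List β => y.2.1 :: y.2.2)
    hl.reverse hl' ((fst.comp snd).cons (snd.comp snd)) (q + q') (by
      intro x m hm
      rw [key]
      have h₁ := sz_append m.reverse (l' x)
      have h₂ := sz_le_of_prefix hm
      have h₃ := hq x
      have h₄ := hq' x
      rw [sz_reverse] at h₁ h₂
      rw [Polynomial.eval_add]
      omega)
  exact h.of_eq fun x => by rw [key, List.reverse_reverse]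

theorem flatMap {l : α → List β} {f : α → β → List γ} (hl : PolyTime l)
    (hf : PolyTime fun y : α × β => f y.1 y.2) : PolyTime fun x => (l x).flatMap (f x) := by
  obtain ⟨q, hq⟩ := hl.exists_sz_le
  obtain ⟨q', hq'⟩ := hf.exists_sz_le
  have key : ∀ (x : α) (l : List β) (s : List γ),
      l.foldl (fun s b => s ++ f x b) s = s ++ l.flatMap (f x) := by
    intro x l
    induction l with
    | nil => simp
    | cons b l ih => intro s; simp [ih]
  have key' : ∀ (x : α) (l : List β) (M : ℕ), (∀ b ∈ l, sz (f x b) ≤ M) →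
      sz (l.flatMap (f x)) ≤ l.length * M + 1 := by
    intro x l M
    induction l with
    | nil => simp
    | cons b l ih =>
      intro h
      have h₁ := sz_append (f x b) (l.flatMap (f x))
      have h₂ := ih fun b hb => h b (by simp [hb])
      have h₃ := h b (by simp)
      rw [List.flatMap_cons, List.length_cons, Nat.succ_mul]
      omega
  have h := foldl (s₀ := fun _ : α => ([] : List γ))
    (f := fun y : α × β × List γ => y.2.2 ++ f y.1 y.2.1) hl (const _)
    ((snd.comp snd).append (hf.comp (fst.pair (fst.comp snd))))
    -- The number of blocks times the bound on one block, whose input `(x, b)` has size at most `sz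
    -- x + q.eval (sz x) + 1`.
    (q * q'.comp (.X + q + 1) + 1) (by
      intro x m hm
      rw [key, List.nil_append]
      simp only [Polynomial.eval_add, Polynomial.eval_mul, Polynomial.eval_comp, Polynomial.eval_X,
        Polynomial.eval_one]
      refine (key' x m (q'.eval (sz x + q.eval (sz x) + 1)) fun b hb => ?_).trans ?_
      · refine (hq' (x, b)).trans (eval_mono _ ?_)
        have := (sz_le_of_mem (hm.subset hb)).trans (hq x)
        simp; omega
      · have h₁ := (hm.length_le.trans (length_le_sz _)).trans (hq x)
        gcongr)
  exact h.of_eq fun x => by rw [key, List.nil_append]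

theorem map {l : α → List β} {f : α → β → γ} (hl : PolyTime l)
    (hf : PolyTime fun y : α × β => f y.1 y.2) : PolyTime fun x => (l x).map (f x) :=
  (hl.flatMap (f := fun x b => [f x b]) (hf.cons (const []))).of_eq fun x => by
    rw [List.map_eq_flatMap]

theorem filter {l : α → List β} {p : α → β → Bool} (hl : PolyTime l)
    (hp : PolyTime fun y : α × β => p y.1 y.2) : PolyTime fun x => (l x).filter (p x) :=
  (hl.flatMap (f := fun x b => if p x b then [b] else [])
    (hp.ite (snd.cons (const [])) (const []))).of_eq fun x => by
      induction l x with
      | nil => rfl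
      | cons b l ih => by_cases h : p x b <;> simp [h, ih]

theorem any {l : α → List β} {p : α → β → Bool} (hl : PolyTime l)
    (hp : PolyTime fun y : α × β => p y.1 y.2) : PolyTime fun x => (l x).any (p x) := by
  have key : ∀ (x : α) (l : List β) (s : Bool),
      l.foldl (fun s b => s || p x b) s = (s || l.any (p x)) := by
    intro x l
    induction l with
    | nil => simp
    | cons b l ih => intro s; simp [ih, Bool.or_assoc]
  have h := foldl (s₀ := fun _ : α => false) (f := fun y : α × β × Bool => y.2.2 || p y.1 y.2.1) hl
    (const _) ((snd.comp snd).or (hp.comp (fst.pair (fst.comp snd)))) 3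
    fun x l' _ => (sz_bool_le _).trans (by simp)
  exact h.of_eq fun x => by rw [key, Bool.false_or]

theorem mem [LawfulEnc β] {f : α → β} {l : α → List β} [∀ x, Decidable (f x ∈ l x)]
    (hf : PolyTime f) (hl : PolyTime l) : PolyTime fun x => decide (f x ∈ l x) := by
  classical
  refine (hl.any (p := fun x b => decide (f x = b)) ((hf.comp fst).eq snd)).of_eq fun x => ?_
  rw [Bool.eq_iff_iff]
  simp

theorem tail {l : α → List β} (hl : PolyTime l) : PolyTime fun x => (l x).tail :=
  (listCases hl (const []) (k := fun y : β × List β × α => y.2.1) (fst.comp snd)).of_eq fun x => by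
    cases l x <;> rfl

theorem take_one {l : α → List β} (hl : PolyTime l) : PolyTime fun x => (l x).take 1 :=
  (listCases hl (const []) (k := fun y : β × List β × α => [y.1])
    (fst.cons (const []))).of_eq fun x => by cases l x <;> simp

theorem drop {l : α → List β} (hl : PolyTime l) (n : ℕ) : PolyTime fun x => (l x).drop n := by
  induction n with
  | zero => simpa using hl
  | succ n ih => simpa using ih.tail

/-- The list `cs` is fixed and its elements need no encoding: the program is unrolled over it. The
valid permutations and the interpreted symbols enter the program in this way. -/
theorem any_const {C : Type} (cs : List C) {p : C → α → Bool} (h : ∀ c, PolyTime (p c)) :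
    PolyTime fun x => cs.any fun c => p c x := by
  induction cs with
  | nil => exact (const false).of_eq fun x => by simp
  | cons c cs ih => exact ((h c).or ih).of_eq fun x => by simp

theorem flatMap_const {C : Type} (cs : List C) {f : C → α → List β} (h : ∀ c, PolyTime (f c)) :
    PolyTime fun x => cs.flatMap fun c => f c x := by
  induction cs with
  | nil => exact (const []).of_eq fun x => by simp
  | cons c cs ih => exact ((h c).append ih).of_eq fun x => by simp

theorem allRel {l l' : α → List β} {r : α → β → β → Bool} (hl : PolyTime l) (hl' : PolyTime l')
    (hr : PolyTime fun y : α × β × β => r y.1 y.2.1 y.2.2) :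
    PolyTime fun x => allRel (r x) (l x) (l' x) := by
  obtain ⟨q, hq⟩ := hl'.exists_sz_le
  -- The accumulator consists of the unread part of the second list, always a suffix and hence of
  -- bounded size, and the verdict so far.
  set step : α × β × (List β × Bool) → List β × Bool := fun y =>
    y.2.2.1.casesOn (motive := fun _ => List β × Bool) ([], false)
      fun v vs => (vs, y.2.2.2 && r y.1 y.2.1 v) with hstep
  have hs : PolyTime step :=
    listCases (l := fun y : α × β × (List β × Bool) => y.2.2.1) (fst.comp (snd.comp snd))
      (const ([], false))
      (k := fun z : β × List β × (α × β × (List β × Bool)) =>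
        (z.2.1, z.2.2.2.2.2 && r z.2.2.1 z.2.2.2.1 z.1))
      ((fst.comp snd).pair ((snd.comp (snd.comp (snd.comp (snd.comp snd)))).and
        (hr.comp ((fst.comp (snd.comp snd)).pair
          ((fst.comp (snd.comp (snd.comp snd))).pair fst)))))
  have key : ∀ (x : α) (us vs : List β) (ok : Bool),
      (us.foldl (fun s u => step (x, u, s)) (vs, ok)).1 <:+ vs ∧
      (us.foldl (fun s u => step (x, u, s)) (vs, ok)).2 = (ok && PermWord.allRel (r x) us vs) := by
    intro x us
    induction us with
    | nil => simp [PermWord.allRel]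
    | cons u us ih =>
      intro vs ok
      cases vs with
      | nil =>
        obtain ⟨h₁, h₂⟩ := ih [] false
        exact ⟨h₁, by simpa [PermWord.allRel] using h₂⟩
      | cons v vs =>
        obtain ⟨h₁, h₂⟩ := ih vs (ok && r x u v)
        exact ⟨h₁.trans (List.suffix_cons _ _), by
          simpa [PermWord.allRel, Bool.and_assoc] using h₂⟩
  have h := foldl (s₀ := fun x => (l' x, true)) hl (hl'.pair (const true)) hs (q + 4) (by
    intro x m _
    have h₁ := (sz_le_of_suffix (key x m (l' x) true).1).trans (hq x)
    have h₂ := sz_bool_le (m.foldl (fun s u => step (x, u, s)) (l' x, true)).2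
    have h₃ : ∀ y : List β × Bool, sz y = sz y.1 + sz y.2 + 1 := fun y => rfl
    rw [h₃, Polynomial.eval_add, Polynomial.eval_ofNat]
    omega)
  refine (snd.comp h).of_eq fun x => ?_
  rw [(key x _ _ _).2, Bool.true_and]

end PolyTime

/-! ### The congruence closure algorithm. -/

variable {L : FirstOrder.Language.{0, 0}}

/-- The topmost function symbol of a ground term. -/
def sym : GroundTerm L → Σ n, L.Functions n
  | .var a => a.elim
  | .func (l := n) f _ => ⟨n, f⟩

/-- The arguments of the topmost function symbol of a ground term. -/
def args : GroundTerm L → List (GroundTerm L)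
  | .var a => a.elim
  | .func _ ts => List.ofFn ts

/-- The subterms of a ground term. -/
def subterms : GroundTerm L → List (GroundTerm L)
  | .var a => a.elim
  | .func f ts => .func f ts :: (List.ofFn fun i => subterms (ts i)).flatten

theorem mem_subterms_self : ∀ t : GroundTerm L, t ∈ subterms t
  | .func f ts => by simp [subterms]

theorem mem_subterms_of_func {n : ℕ} {f : L.Functions n} {ts : Fin n → GroundTerm L} (i : Fin n) :
    ∀ {t : GroundTerm L}, .func f ts ∈ subterms t → ts i ∈ subterms t
  | .func g us, h => by
    simp only [subterms, List.mem_cons, List.mem_flatten, List.mem_ofFn] at h ⊢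
    rcases h with h | ⟨_, ⟨j, rfl⟩, hj⟩
    · cases h
      exact .inr ⟨_, ⟨i, rfl⟩, mem_subterms_self _⟩
    · exact .inr ⟨_, ⟨j, rfl⟩, mem_subterms_of_func i hj⟩

/-- The list `l` permuted by `ρ`. -/
def permList {α : Type} {n : ℕ} (ρ : Equiv.Perm (Fin n)) (l : List α) : List α :=
  (List.finRange n).flatMap fun i => (l.drop (ρ i)).take 1

theorem permList_ofFn {α : Type} {n : ℕ} (ρ : Equiv.Perm (Fin n)) (ts : Fin n → α) :
    permList ρ (List.ofFn ts) = List.ofFn fun i => ts (ρ i) := by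
  have h : ∀ i : Fin n, ((List.ofFn ts).drop (ρ i)).take 1 = [ts (ρ i)] := by
    intro i
    rw [List.drop_eq_getElem_cons (by simp)]
    simp
  rw [permList, List.ofFn_eq_map (f := fun i => ts (ρ i)), List.map_eq_flatMap]
  simp only [h]

/-- A function symbol together with a permutation of its arguments. -/
abbrev PermRule (L : FirstOrder.Language.{0, 0}) : Type := Σ f : (Σ n, L.Functions n), Equiv.Perm (Fin f.1)

section algorithm

open Classical in
/-- The relation given by a list of pairs. -/
noncomputable def rel {α : Type} (R : List (α × α)) (u v : α) : Bool := decide ((u, v) ∈ R)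

theorem rel_iff {α : Type} {R : List (α × α)} {u v : α} : rel R u v = true ↔ (u, v) ∈ R := by
  simp [rel]

/-- Consequence of idempotency. -/
noncomputable def idemStep (R : List (GroundTerm L × GroundTerm L)) (u v : GroundTerm L) : Bool :=
  allRel (rel R) (args u) [v, v]

open Classical in
/-- Consequence of nilpotency. -/
noncomputable def nilpStep (z : L.Constants) (R : List (GroundTerm L × GroundTerm L))
    (u v : GroundTerm L) : Bool :=
  -- For two arguments, comparing the first one with the tail relates them to each other.
  allRel (rel R) ((args u).take 1) (args u).tail && decide (v = z.term)

/-- Consequence of the unit equations. -/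
noncomputable def unitStep (z : L.Constants) (R : List (GroundTerm L × GroundTerm L))
    (u v : GroundTerm L) : Bool :=
  allRel (rel R) (args u) [v, z.term] || allRel (rel R) (args u) [z.term, v]

/-- Consequence of the rules of an interpreted symbol. -/
noncomputable def symbolStep :
    InterpretedBy L → List (GroundTerm L × GroundTerm L) → GroundTerm L → GroundTerm L → Bool
  | .idem, R, u, v => idemStep R u v
  | .nilp z, R, u, v => nilpStep z R u v
  | .unit z, R, u, v => unitStep z R u v
  | .idemUnit z, R, u, v => idemStep R u v || unitStep z R u v
  | .nilpUnit z, R, u, v => nilpStep z R u v || unitStep z R u v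

variable (perms : List (PermRule L)) (ints : List (L.Functions 2 × InterpretedBy L))

open Classical in
/-- `(u, v)` follows in one step from the pairs in `R`. -/
noncomputable def step (T : List (GroundTerm L)) (P R : List (GroundTerm L × GroundTerm L))
    (u v : GroundTerm L) : Bool :=
  -- The second disjunct, a common related term `w`, yields both symmetry and transitivity once
  -- reflexivity is available.
  decide (u = v) || (T.any (fun w => rel R u w && rel R v w) || (rel P u v ||
    ((decide (sym u = sym v) && allRel (rel R) (args u) (args v)) ||
    ((perms.any fun c => decide (sym u = c.1) && (decide (sym v = c.1) &&
      allRel (rel R) (args u) (permList c.2 (args v)))) ||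
    ints.any fun c => decide (sym u = ⟨2, c.1⟩) && symbolStep c.2 R u v))))

/-- All pairs of elements of a list. -/
def pairs {α : Type} (T : List α) : List (α × α) := T.flatMap fun u => T.map fun v => (u, v)

theorem mem_pairs {α : Type} {T : List α} {u v : α} : (u, v) ∈ pairs T ↔ u ∈ T ∧ v ∈ T := by
  simp [pairs]

/-- All pairs that follow in one step from the pairs in `R`. -/
noncomputable def next (T : List (GroundTerm L)) (P R : List (GroundTerm L × GroundTerm L)) :
    List (GroundTerm L × GroundTerm L) :=
  (pairs T).filter fun x => step perms ints T P R x.1 x.2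

/-- The congruence closure of `P` on `T`. -/
noncomputable def closure (T : List (GroundTerm L)) (P : List (GroundTerm L × GroundTerm L)) :
    List (GroundTerm L × GroundTerm L) :=
  -- The list of pairs serves only as a clock: its elements are ignored and its length is a
  -- sufficient number of rounds.
  (pairs T).foldl (fun R _ => next perms ints T P R) []

/-- Iterating a monotone filter. -/
theorem exists_fixpoint {α : Type} (A : List α) (p : List α → α → Bool)
    (hp : ∀ R R', R ⊆ R' → ∀ x, p R x = true → p R' x = true) :
    A.filter (p ((fun R => A.filter (p R))^[A.length] [])) =
      (fun R => A.filter (p R))^[A.length] [] := by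
  set F : List α → List α := fun R => A.filter (p R) with hF
  have hsub : ∀ k, List.Sublist (F^[k] []) (F^[k + 1] []) := by
    intro k
    induction k with
    | zero => exact List.nil_sublist _
    | succ k ih =>
      rw [Function.iterate_succ_apply', Function.iterate_succ_apply' F (k + 1)]
      exact List.monotone_filter_right _ fun x => hp _ _ ih.subset x
  -- Until the iteration is stationary every round adds an element, so |A| + 1 strict rounds would
  -- exceed the length of `A`.
  have key : ∀ k, F^[k + 1] [] = F^[k] [] ∨ k + 1 ≤ (F^[k + 1] []).length := by
    intro k
    induction k with
    | zero =>
      rcases h : F [] with _ | ⟨x, l⟩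
      · exact .inl h
      · right; simp [h]
    | succ k ih =>
      by_cases h : F^[k + 2] [] = F^[k + 1] []
      · exact .inl h
      · right
        have h₁ : F^[k + 1] [] ≠ F^[k] [] := fun h' => h (by
          rw [Function.iterate_succ_apply' F (k + 1), h', ← Function.iterate_succ_apply' F k, h'])
        have h₂ := ih.resolve_left h₁
        have h₃ : (F^[k + 1] []).length ≠ (F^[k + 2] []).length := fun h' =>
          h ((hsub (k + 1)).eq_of_length h').symm
        have h₄ := (hsub (k + 1)).length_le
        change (F^[k + 1] []).length ≤ (F^[k + 2] []).length at h₄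
        change k + 2 ≤ (F^[k + 2] []).length
        omega
  rcases key A.length with h | h
  · rwa [Function.iterate_succ_apply'] at h
  · rw [Function.iterate_succ_apply'] at h
    have := List.length_filter_le (p (F^[A.length] [])) A
    change _ ≤ (A.filter (p (F^[A.length] []))).length at h
    omega

theorem allRel_mono {α : Type} {r r' : α → α → Bool} (h : ∀ x y, r x y = true → r' x y = true) :
    ∀ us vs : List α, allRel r us vs = true → allRel r' us vs = true
  | [], _, _ => rfl
  | _ :: _, [], h' => by simp [allRel] at h'
  | u :: us, v :: vs, h' => by
    simp only [allRel, Bool.and_eq_true] at h' ⊢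
    exact ⟨h _ _ h'.1, allRel_mono h us vs h'.2⟩

variable {perms ints}

theorem step_mono {T : List (GroundTerm L)} {P R R' : List (GroundTerm L × GroundTerm L)}
    (h : R ⊆ R') {u v : GroundTerm L} (hs : step perms ints T P R u v = true) :
    step perms ints T P R' u v = true := by
  have hr : ∀ x y, rel R x y = true → rel R' x y = true := fun x y hxy =>
    rel_iff.2 (h (rel_iff.1 hxy))
  have ha := allRel_mono hr
  simp only [step, Bool.or_eq_true, List.any_eq_true, Bool.and_eq_true] at hs ⊢
  rcases hs with hs | ⟨w, hw, h₁, h₂⟩ | hs | ⟨h₁, h₂⟩ | ⟨c, hc, h₁, h₂, h₃⟩ | ⟨c, hc, h₁, h₂⟩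
  · exact .inl hs
  · exact .inr (.inl ⟨w, hw, hr _ _ h₁, hr _ _ h₂⟩)
  · exact .inr (.inr (.inl hs))
  · exact .inr (.inr (.inr (.inl ⟨h₁, ha _ _ h₂⟩)))
  · exact .inr (.inr (.inr (.inr (.inl ⟨c, hc, h₁, h₂, ha _ _ h₃⟩))))
  · refine .inr (.inr (.inr (.inr (.inr ⟨c, hc, h₁, ?_⟩))))
    rcases c with ⟨g, _ | z | z | z | z⟩ <;>
      simp only [symbolStep, idemStep, nilpStep, unitStep, Bool.or_eq_true, Bool.and_eq_true]
        at h₂ ⊢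
    · exact ha _ _ h₂
    · exact ⟨ha _ _ h₂.1, h₂.2⟩
    · exact h₂.imp (ha _ _) (ha _ _)
    · exact h₂.imp (ha _ _) (.imp (ha _ _) (ha _ _))
    · exact h₂.imp (.imp_left (ha _ _)) (.imp (ha _ _) (ha _ _))

theorem closure_eq_iterate (T : List (GroundTerm L)) (P : List (GroundTerm L × GroundTerm L)) :
    closure perms ints T P = (next perms ints T P)^[(pairs T).length] [] := by
  rw [closure, List.foldl_const]

theorem next_closure (T : List (GroundTerm L)) (P : List (GroundTerm L × GroundTerm L)) :
    next perms ints T P (closure perms ints T P) = closure perms ints T P := by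
  rw [closure_eq_iterate]
  exact exists_fixpoint (pairs T) (fun R x => step perms ints T P R x.1 x.2)
    fun R R' h x => step_mono h

/-- This is the fixed-point equation, the only fact about the iteration that completeness uses. -/
theorem mem_closure_iff {T : List (GroundTerm L)} {P : List (GroundTerm L × GroundTerm L)}
    {u v : GroundTerm L} : (u, v) ∈ closure perms ints T P ↔
      u ∈ T ∧ v ∈ T ∧ step perms ints T P (closure perms ints T P) u v = true := by
  conv_lhs => rw [← next_closure]
  rw [next, List.mem_filter, mem_pairs, and_assoc]

theorem closure_induction {T : List (GroundTerm L)} {P : List (GroundTerm L × GroundTerm L)}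
    {Q : GroundTerm L → GroundTerm L → Prop}
    (h : ∀ R, (∀ u v, (u, v) ∈ R → Q u v) → ∀ u v, step perms ints T P R u v = true → Q u v) :
    ∀ u v, (u, v) ∈ closure perms ints T P → Q u v := by
  rw [closure_eq_iterate]
  generalize (pairs T).length = k
  induction k with
  | zero => simp
  | succ k ih =>
    intro u v huv
    rw [Function.iterate_succ_apply', next, List.mem_filter] at huv
    exact h _ ih u v huv.2

end algorithm

/-! ### Valid permutations and soundness of the closure. -/

variable {L : FirstOrder.Language.{0, 0}}

theorem EqTheory.mono {S S' : Set (Equation L)} (h : S ⊆ S') {s t : L.Term ℕ}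
    (hst : EqTheory S s t) : EqTheory S' s t := by
  induction hst with
  | base hm => exact .base (h hm)
  | refl t => exact .refl t
  | symm _ ih => exact .symm ih
  | trans _ _ ih ih' => exact .trans ih ih'
  | congr f ss ts _ ih => exact .congr f ss ts ih
  | subst σ _ ih => exact .subst σ ih

/-- The equation `f(x₁,…,xₙ) ≈ f(x_{ρ(1)},…,x_{ρ(n)})` holds modulo `E`. -/
def ValidPerm (E : Set (Equation L)) {n : ℕ} (f : L.Functions n) (ρ : Equiv.Perm (Fin n)) : Prop :=
  ∀ x : Fin n → L.Term ℕ, EqTheory E (.func f x) (.func f fun i => x (ρ i))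

/-- With `ValidPerm.inv`, the valid permutations form a group. Listing all of them, and not only
those written in `E`, lets one step of the closure cover any chain of permutation equations at the
root. -/
theorem ValidPerm.mul {E : Set (Equation L)} {n : ℕ} {f : L.Functions n}
    {ρ τ : Equiv.Perm (Fin n)} (hρ : ValidPerm E f ρ) (hτ : ValidPerm E f τ) :
    ValidPerm E f (ρ * τ) := fun x => (hρ x).trans (hτ fun i => x (ρ i))

theorem ValidPerm.inv {E : Set (Equation L)} {n : ℕ} {f : L.Functions n}
    {ρ : Equiv.Perm (Fin n)} (hρ : ValidPerm E f ρ) : ValidPerm E f ρ⁻¹ := fun x => by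
  have h := hρ fun i => x (ρ⁻¹ i)
  simp only [Equiv.Perm.inv_def, Equiv.symm_apply_apply] at h
  exact h.symm

/-- The function symbols that occur at the top of the left-hand sides of `E`. -/
def headSymbols (E : Set (Equation L)) : Set (Σ n, L.Functions n) :=
  {f | ∃ e ∈ E, ∃ ts, e.1 = .func f.2 ts}

theorem finite_headSymbols {E : Set (Equation L)} (hE : E.Finite) : (headSymbols E).Finite := by
  let g : L.Term ℕ → Option (Σ n, L.Functions n) := fun
    | .var _ => none
    | .func (l := n) f _ => some ⟨n, f⟩
  refine ((hE.image fun e => g e.1).preimage (Option.some_injective _).injOn).subset ?_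
  rintro f ⟨e, he, ts, h⟩
  exact ⟨e, he, by simp only [h, g]⟩

/-- The valid permutations of the arguments of the symbols in `E` form a finite set. -/
theorem exists_permRules {E : Set (Equation L)} (hE : E.Finite) : ∃ l : List (PermRule L),
    ∀ c, c ∈ l ↔ c.1 ∈ headSymbols E ∧ ValidPerm E c.1.2 c.2 := by
  -- There are finitely many head symbols, each with finitely many permutations. Validity need not
  -- be computed, as the list is part of the fixed program.
  have h : {c : PermRule L | c.1 ∈ headSymbols E ∧ ValidPerm E c.1.2 c.2}.Finite := by
    have : {c : PermRule L | c.1 ∈ headSymbols E}.Finite := by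
      refine (finite_headSymbols hE).preimage' fun f _ => ?_
      refine ((Set.finite_univ (α := Equiv.Perm (Fin f.1))).image (Sigma.mk f)).subset ?_
      rintro ⟨f', ρ⟩ rfl
      exact ⟨ρ, trivial, rfl⟩
    exact this.subset fun c hc => hc.1
  refine ⟨h.toFinset.toList, fun c => ?_⟩
  simp

/-- The interpreted symbols with their properties form a finite set. -/
theorem exists_interpreted {B : L.Functions 2 → Option (InterpretedBy L)}
    (hB : {g | B g ≠ none}.Finite) : ∃ l : List (L.Functions 2 × InterpretedBy L),
    ∀ c, c ∈ l ↔ B c.1 = some c.2 := by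
  have h : {c : L.Functions 2 × InterpretedBy L | B c.1 = some c.2}.Finite := by
    refine Set.Finite.of_finite_image (hB.subset ?_) (f := Prod.fst) ?_
    · rintro _ ⟨c, hc, rfl⟩
      simp only [Set.mem_ofPred_eq] at hc ⊢
      simp [hc]
    · rintro ⟨g, p⟩ hc ⟨g', p'⟩ hc' h
      simp only [Set.mem_ofPred_eq] at hc hc' h
      subst h
      rw [hc] at hc'
      rw [Option.some.inj hc']
  exact ⟨h.toFinset.toList, fun c => by simp⟩

/-- The constants of an interpreted symbol. -/
def InterpretedBy.constants : InterpretedBy L → List (GroundTerm L)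
  | .idem => []
  | .nilp z => [z.term]
  | .unit z => [z.term]
  | .idemUnit z => [z.term]
  | .nilpUnit z => [z.term]

theorem toTerm_term (z : L.Constants) : toTerm (L := L) z.term = z.term := by
  simp only [toTerm, FirstOrder.Language.Constants.term, FirstOrder.Language.Term.relabel]
  congr 1
  funext i
  exact i.elim0

theorem toTerm_func {n : ℕ} (f : L.Functions n) (ts : Fin n → GroundTerm L) :
    toTerm (.func f ts) = .func f fun i => toTerm (ts i) := rfl

theorem term_subst (z : L.Constants) (σ : ℕ → L.Term ℕ) :
    (z.term : L.Term ℕ).subst σ = z.term := by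
  simp only [FirstOrder.Language.Constants.term, FirstOrder.Language.Term.subst]
  congr 1
  funext i
  exact i.elim0

theorem apply₂_subst (g : L.Functions 2) (s t : L.Term ℕ) (σ : ℕ → L.Term ℕ) :
    (g.apply₂ s t).subst σ = g.apply₂ (s.subst σ) (t.subst σ) := by
  simp only [FirstOrder.Language.Functions.apply₂, FirstOrder.Language.Term.subst]
  congr 1
  funext i
  fin_cases i <;> rfl

section soundness

variable {S : Set (Equation L)} {g : L.Functions 2}

theorem EqTheory.apply₂ {ts : Fin 2 → L.Term ℕ} {s t : L.Term ℕ} (h₀ : EqTheory S (ts 0) s)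
    (h₁ : EqTheory S (ts 1) t) : EqTheory S (.func g ts) (g.apply₂ s t) :=
  .congr g _ _ fun i => by fin_cases i <;> assumption

theorem EqTheory.idem (h : idemRules g ⊆ S) (s : L.Term ℕ) : EqTheory S (g.apply₂ s s) s := by
  have h := EqTheory.subst (fun _ => s) (.base (h rfl))
  rwa [apply₂_subst] at h

theorem EqTheory.nilp {z : L.Constants} (h : nilpRules g z ⊆ S) (s : L.Term ℕ) :
    EqTheory S (g.apply₂ s s) z.term := by
  have h := EqTheory.subst (fun _ => s) (.base (h rfl))
  rwa [apply₂_subst, term_subst] at h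

theorem EqTheory.unit_right {z : L.Constants} (h : unitRules g z ⊆ S) (s : L.Term ℕ) :
    EqTheory S (g.apply₂ s z.term) s := by
  have h := EqTheory.subst (fun _ => s) (.base (h (.inl rfl)))
  rwa [apply₂_subst, term_subst] at h

theorem EqTheory.unit_left {z : L.Constants} (h : unitRules g z ⊆ S) (s : L.Term ℕ) :
    EqTheory S (g.apply₂ z.term s) s := by
  have h := EqTheory.subst (fun _ => s) (.base (h (.inr rfl)))
  rwa [apply₂_subst, term_subst] at h

theorem allRel_two {α : Type} {R : List (α × α)} {ts : Fin 2 → α} {a b : α} :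
    allRel (rel R) (List.ofFn ts) [a, b] = true ↔ (ts 0, a) ∈ R ∧ (ts 1, b) ∈ R := by
  simp [List.ofFn_succ, allRel, rel_iff]

theorem allRel_take_tail {α : Type} {R : List (α × α)} {ts : Fin 2 → α} :
    allRel (rel R) ((List.ofFn ts).take 1) (List.ofFn ts).tail = true ↔ (ts 0, ts 1) ∈ R := by
  simp [List.ofFn_succ, allRel, rel_iff]

variable {R : List (GroundTerm L × GroundTerm L)} {ts : Fin 2 → GroundTerm L} {v : GroundTerm L}

theorem idemStep_iff : idemStep R (.func g ts) v = true ↔ (ts 0, v) ∈ R ∧ (ts 1, v) ∈ R :=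
  allRel_two

theorem nilpStep_iff {z : L.Constants} :
    nilpStep z R (.func g ts) v = true ↔ (ts 0, ts 1) ∈ R ∧ v = z.term := by
  simp only [nilpStep, args, Bool.and_eq_true, decide_eq_true_eq, allRel_take_tail]

theorem unitStep_iff {z : L.Constants} : unitStep z R (.func g ts) v = true ↔
    ((ts 0, v) ∈ R ∧ (ts 1, z.term) ∈ R) ∨ ((ts 0, z.term) ∈ R ∧ (ts 1, v) ∈ R) := by
  simp only [unitStep, args, Bool.or_eq_true, allRel_two]

theorem symbolStep_sound (hR : ∀ u v, (u, v) ∈ R → EqTheory S (toTerm u) (toTerm v))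
    {p : InterpretedBy L} (hS : symbolRules g p ⊆ S)
    (h : symbolStep p R (.func g ts) v = true) :
    EqTheory S (toTerm (.func g ts)) (toTerm v) := by
  have hi : idemRules g ⊆ S → idemStep R (.func g ts) v = true →
      EqTheory S (toTerm (.func g ts)) (toTerm v) := fun hS h => by
    obtain ⟨h₀, h₁⟩ := idemStep_iff.1 h
    rw [toTerm_func]
    exact (EqTheory.apply₂ (hR _ _ h₀) (hR _ _ h₁)).trans (.idem hS _)
  have hn : ∀ z, nilpRules g z ⊆ S → nilpStep z R (.func g ts) v = true →
      EqTheory S (toTerm (.func g ts)) (toTerm v) := fun z hS h => by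
    obtain ⟨h₀, rfl⟩ := nilpStep_iff.1 h
    rw [toTerm_func, toTerm_term]
    exact (EqTheory.apply₂ (hR _ _ h₀) (.refl _)).trans (.nilp hS _)
  have hu : ∀ z, unitRules g z ⊆ S → unitStep z R (.func g ts) v = true →
      EqTheory S (toTerm (.func g ts)) (toTerm v) := fun z hS h => by
    rw [toTerm_func]
    rcases unitStep_iff.1 h with ⟨h₀, h₁⟩ | ⟨h₀, h₁⟩
    · have h₁ := hR _ _ h₁
      rw [toTerm_term] at h₁
      exact (EqTheory.apply₂ (hR _ _ h₀) h₁).trans (.unit_right hS _)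
    · have h₀ := hR _ _ h₀
      rw [toTerm_term] at h₀
      exact (EqTheory.apply₂ h₀ (hR _ _ h₁)).trans (.unit_left hS _)
  rcases p with _ | z | z | z | z
  · exact hi hS h
  · exact hn z hS h
  · exact hu z hS h
  · rcases Bool.or_eq_true _ _ ▸ h with h | h
    · exact hi (Set.subset_union_left.trans hS) h
    · exact hu z (Set.subset_union_right.trans hS) h
  · rcases Bool.or_eq_true _ _ ▸ h with h | h
    · exact hn z (Set.subset_union_left.trans hS) h
    · exact hu z (Set.subset_union_right.trans hS) h

variable {E : Set (Equation L)} {B : L.Functions 2 → Option (InterpretedBy L)}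
  {perms : List (PermRule L)} {ints : List (L.Functions 2 × InterpretedBy L)}

/-- Pairs in the closure are equal modulo the theory. -/
theorem closure_sound (hE : E ⊆ S) (hB : rules B ⊆ S)
    (hperms : ∀ c ∈ perms, ValidPerm E c.1.2 c.2) (hints : ∀ c ∈ ints, B c.1 = some c.2)
    {T : List (GroundTerm L)} {P : List (GroundTerm L × GroundTerm L)}
    (hP : ∀ p ∈ P, EqTheory S (toTerm p.1) (toTerm p.2)) :
    ∀ u v, (u, v) ∈ closure perms ints T P → EqTheory S (toTerm u) (toTerm v) := by
  refine closure_induction fun R hR u v h => ?_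
  simp only [step, Bool.or_eq_true, List.any_eq_true, Bool.and_eq_true, decide_eq_true_eq,
    rel_iff] at h
  rcases h with rfl | ⟨w, -, h₁, h₂⟩ | h | ⟨h₁, h₂⟩ | ⟨c, hc, h₁, h₂, h₃⟩ | ⟨c, hc, h₁, h₂⟩
  · exact .refl _
  · exact (hR _ _ h₁).trans (hR _ _ h₂).symm
  · exact hP _ h
  · rcases u with a | ⟨f, us⟩
    · exact a.elim
    rcases v with a | ⟨g, vs⟩
    · exact a.elim
    simp only [sym] at h₁
    cases h₁
    simp only [args, allRel_ofFn, rel_iff] at h₂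
    exact .congr f _ _ fun i => hR _ _ (h₂ i)
  · rcases c with ⟨⟨n, f⟩, ρ⟩
    rcases u with a | ⟨f', us⟩
    · exact a.elim
    rcases v with a | ⟨g, vs⟩
    · exact a.elim
    simp only [sym] at h₁ h₂
    cases h₁
    cases h₂
    simp only [args, permList_ofFn, allRel_ofFn, rel_iff] at h₃
    exact EqTheory.trans (.congr f _ _ fun i => hR _ _ (h₃ i))
      ((hperms _ hc fun i => toTerm (vs i)).mono hE).symm
  · rcases c with ⟨g, p⟩
    rcases u with a | ⟨f', us⟩
    · exact a.elim
    simp only [sym] at h₁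
    cases h₁
    exact symbolStep_sound hR (fun e he => hB ⟨g, p, hints _ hc, he⟩) h₂

end soundness

/-! ### Completeness of the closure by construction of a model. -/

variable {L : FirstOrder.Language.{0, 0}}

theorem ValidPerm.of_mem {E : Set (Equation L)} {n : ℕ} {f : L.Functions n}
    {ρ : Equiv.Perm (Fin n)} {x : Fin n → ℕ} (hx : Function.Injective x)
    (he : ((.func f fun i => .var (x i), .func f fun i => .var (x (ρ i))) : Equation L) ∈ E) :
    ValidPerm E f ρ := by
  intro y
  -- `Function.invFun` needs a nonempty index type, so arity zero, where the permutation is trivial,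
  -- is treated apart.
  rcases n with _ | n
  · rw [show (fun i => y (ρ i)) = y from funext fun i => i.elim0]
    exact .refl _
  have h := EqTheory.subst (fun k => y (Function.invFun x k)) (.base he)
  simpa [FirstOrder.Language.Term.subst, Function.leftInverse_invFun hx _] using h

section eval

variable {M : Type} (F : ∀ {n : ℕ}, L.Functions n → (Fin n → M) → M)

/-- The value of a term in an algebra. -/
def eval {α : Type} (v : α → M) : L.Term α → M
  | .var a => v a
  | .func f ts => F f fun i => eval v (ts i)

theorem eval_subst {α β : Type} (v : β → M) (σ : α → L.Term β) :
    ∀ t : L.Term α, eval F v (t.subst σ) = eval F (fun a => eval F v (σ a)) t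
  | .var _ => rfl
  | .func f ts => congrArg (F f) (funext fun i => eval_subst v σ (ts i))

/-- Every algebra that satisfies `S` satisfies the equational theory of `S`. -/
theorem EqTheory.eval_eq {S : Set (Equation L)}
    (hS : ∀ e ∈ S, ∀ v : ℕ → M, eval F v e.1 = eval F v e.2) {s t : L.Term ℕ}
    (h : EqTheory S s t) (v : ℕ → M) : eval F v s = eval F v t := by
  induction h generalizing v with
  | base h => exact hS _ h v
  | refl t => rfl
  | symm _ ih => exact (ih v).symm
  | trans _ _ ih ih' => exact (ih v).trans (ih' v)
  | congr f ss ts _ ih => exact congrArg (F f) (funext fun i => ih i v)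
  | subst σ _ ih => rw [eval_subst, eval_subst, ih]

theorem eval_apply₂ {α : Type} (v : α → M) (g : L.Functions 2) (s t : L.Term α) :
    eval F v (g.apply₂ s t) = F g ![eval F v s, eval F v t] := by
  simp only [FirstOrder.Language.Functions.apply₂, eval]
  congr 1
  funext i
  fin_cases i <;> rfl

end eval

section model

variable (perms : List (PermRule L)) (B : L.Functions 2 → Option (InterpretedBy L))
  (T : List (GroundTerm L)) (R : List (GroundTerm L × GroundTerm L))

/-- The class of a term with respect to a relation. -/
def cls (u : GroundTerm L) : Set (GroundTerm L) := {w | (u, w) ∈ R}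

/-- The permutation `ρ` of the arguments of `f` is the identity or listed in `perms`. -/
def Allowed {n : ℕ} (f : L.Functions n) (ρ : Equiv.Perm (Fin n)) : Prop :=
  ρ = 1 ∨ (⟨⟨n, f⟩, ρ⟩ : PermRule L) ∈ perms

open Classical in
/-- The value `x` if `x = y`, and `d` otherwise. -/
noncomputable def ifEq {M : Type} (x y v d : M) : M := if x = y then v else d

/-- The unit `z` is applied if possible, and otherwise the value is `d`. -/
noncomputable def unitVal {M : Type} (z x y d : M) : M := ifEq x z y (ifEq y z x d)

/-- The value of an interpreted symbol outside of the given partial algebra. -/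
noncomputable def symbolVal : InterpretedBy L → Set (GroundTerm L) → Set (GroundTerm L) →
    Set (GroundTerm L)
  | .idem, x, y => ifEq x y x ∅
  | .nilp z, x, y => ifEq x y (cls R z.term) ∅
  | .unit z, x, y => unitVal (cls R z.term) x y ∅
  -- The unit rule takes precedence. When both arguments are the class of `z`, either rule gives
  -- that class, so the precedence breaks no equation; the same holds for nilpotency.
  | .idemUnit z, x, y => unitVal (cls R z.term) x y (ifEq x y x ∅)
  | .nilpUnit z, x, y => unitVal (cls R z.term) x y (ifEq x y (cls R z.term) ∅)

/-- The value of a function symbol outside of the given partial algebra. -/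
noncomputable def defaultVal : ∀ {n : ℕ}, L.Functions n → (Fin n → Set (GroundTerm L)) →
    Set (GroundTerm L)
  | 2, g, x => (B g).elim ∅ fun p => symbolVal R p (x 0) (x 1)
  -- The empty set is a junk element: by reflexivity of the closure it is not the class of a term in
  -- `T`.
  | _, _, _ => ∅

/-- The terms `f(t₁,…,tₙ)` in `T` whose arguments have the classes `x`, up to a permutation. -/
def IsMatch {n : ℕ} (f : L.Functions n) (x : Fin n → Set (GroundTerm L))
    (ts : Fin n → GroundTerm L) : Prop :=
  .func f ts ∈ T ∧ ∃ ρ, Allowed perms f ρ ∧ ∀ i, cls R (ts i) = x (ρ i)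

open Classical in
/-- The total algebra obtained by completing the partial algebra of the classes of `T`. -/
noncomputable def modelFun {n : ℕ} (f : L.Functions n) (x : Fin n → Set (GroundTerm L)) :
    Set (GroundTerm L) :=
  -- The choice of the match is arbitrary; `IsClosure.modelFun_eq` shows that the class does not
  -- depend on it.
  if h : ∃ ts, IsMatch perms T R f x ts then cls R (.func f h.choose) else defaultVal B R f x

theorem unitVal_comm {M : Type} (z x y : M) {d d' : M} (h : d = d') :
    unitVal z x y d = unitVal z y x d' := by
  subst h
  simp only [unitVal, ifEq]
  split_ifs with h₁ h₂ <;> simp_all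

/-- Symmetry is needed because `E` may make an interpreted symbol commutative, and the completed
algebra has to respect this. -/
theorem symbolVal_comm (p : InterpretedBy L) (x y : Set (GroundTerm L)) :
    symbolVal R p x y = symbolVal R p y x := by
  have h : ∀ v v' : Set (GroundTerm L), (x = y → v = v') → ifEq x y v ∅ = ifEq y x v' ∅ := by
    intro v v' h
    by_cases hxy : x = y
    · simp [ifEq, hxy, h hxy]
    · simp [ifEq, hxy, Ne.symm hxy]
  rcases p with _ | z | z | z | z
  · exact h _ _ fun h => h
  · exact h _ _ fun _ => rfl
  · exact unitVal_comm _ _ _ rfl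
  · exact unitVal_comm _ _ _ (h _ _ fun h => h)
  · exact unitVal_comm _ _ _ (h _ _ fun _ => rfl)

theorem defaultVal_perm {n : ℕ} (f : L.Functions n) (x : Fin n → Set (GroundTerm L))
    (ρ : Equiv.Perm (Fin n)) : defaultVal B R f (fun i => x (ρ i)) = defaultVal B R f x := by
  rcases n with _ | _ | _ | n
  · rfl
  · rfl
  · simp only [defaultVal]
    rcases B f with _ | p
    · rfl
    · simp only [Option.elim]
      have h : ∀ i j : Fin 2, i ≠ j → symbolVal R p (x i) (x j) = symbolVal R p (x 0) (x 1) := by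
        intro i j hij
        fin_cases i <;> fin_cases j <;> first | exact absurd rfl hij | rfl | skip
        exact symbolVal_comm R p _ _
      exact h _ _ fun h => by simpa using ρ.injective h
  · rfl

variable {perms B T R} {E : Set (Equation L)} {ints : List (L.Functions 2 × InterpretedBy L)}
  {P : List (GroundTerm L × GroundTerm L)}

theorem step_of_args {u v w : GroundTerm L} (h : (u, w) ∈ R ∧ (v, w) ∈ R) (hw : w ∈ T) :
    step perms ints T P R u v = true := by
  simp only [step, Bool.or_eq_true, List.any_eq_true, Bool.and_eq_true, rel_iff]
  exact .inr (.inl ⟨w, hw, h⟩)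

/-- `R` is the congruence closure of `P` on `T`. -/
structure IsClosure (perms : List (PermRule L)) (ints : List (L.Functions 2 × InterpretedBy L))
    (T : List (GroundTerm L)) (P R : List (GroundTerm L × GroundTerm L)) : Prop where
  mem_iff : ∀ u v, (u, v) ∈ R ↔ u ∈ T ∧ v ∈ T ∧ step perms ints T P R u v = true
  arg_mem : ∀ {n : ℕ} {f : L.Functions n} {ts : Fin n → GroundTerm L}, .func f ts ∈ T → ∀ i, ts i ∈ T
  const_mem : ∀ c ∈ ints, ∀ z ∈ c.2.constants, z ∈ T

/-- `perms` lists all valid permutations of the arguments of the symbols of `E`. -/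
def IsPermList (E : Set (Equation L)) (perms : List (PermRule L)) : Prop :=
  ∀ c, c ∈ perms ↔ c.1 ∈ headSymbols E ∧ ValidPerm E c.1.2 c.2

/-- The identity is allowed separately, since nothing is listed for symbols that head no equation of
`E`. With `Allowed.inv`, the allowed permutations form a group for every symbol. -/
theorem Allowed.mul (hp : IsPermList E perms) {n : ℕ} {f : L.Functions n}
    {ρ τ : Equiv.Perm (Fin n)} (hρ : Allowed perms f ρ) (hτ : Allowed perms f τ) :
    Allowed perms f (ρ * τ) := by
  rcases hρ with rfl | hρ
  · rwa [one_mul]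
  rcases hτ with rfl | hτ
  · rw [mul_one]; exact .inr hρ
  have h₁ := (hp _).1 hρ
  have h₂ := (hp _).1 hτ
  exact .inr ((hp _).2 ⟨h₁.1, h₁.2.mul h₂.2⟩)

theorem Allowed.inv (hp : IsPermList E perms) {n : ℕ} {f : L.Functions n}
    {ρ : Equiv.Perm (Fin n)} (hρ : Allowed perms f ρ) : Allowed perms f ρ⁻¹ := by
  rcases hρ with rfl | hρ
  · exact .inl inv_one
  have h₁ := (hp _).1 hρ
  exact .inr ((hp _).2 ⟨h₁.1, h₁.2.inv⟩)

namespace IsClosure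

variable (hR : IsClosure perms ints T P R)
include hR

theorem refl {u : GroundTerm L} (hu : u ∈ T) : (u, u) ∈ R :=
  (hR.mem_iff u u).2 ⟨hu, hu, by simp [step]⟩

theorem symm {u v : GroundTerm L} (h : (u, v) ∈ R) : (v, u) ∈ R := by
  have h' := (hR.mem_iff u v).1 h
  exact (hR.mem_iff v u).2 ⟨h'.2.1, h'.1, step_of_args ⟨hR.refl h'.2.1, h⟩ h'.2.1⟩

theorem trans {u v w : GroundTerm L} (h : (u, v) ∈ R) (h' : (v, w) ∈ R) : (u, w) ∈ R := by
  have h₁ := (hR.mem_iff u v).1 h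
  have h₂ := (hR.mem_iff v w).1 h'
  exact (hR.mem_iff u w).2 ⟨h₁.1, h₂.2.1, step_of_args ⟨h, hR.symm h'⟩ h₁.2.1⟩

/-- Membership of `v` in `T` gives reflexivity, so two empty classes cannot be confused with related
terms. -/
theorem cls_eq_iff {u v : GroundTerm L} (hv : v ∈ T) : cls R u = cls R v ↔ (u, v) ∈ R := by
  constructor
  · intro h
    have : v ∈ cls R v := hR.refl hv
    rw [← h] at this
    exact this
  · intro h
    ext w
    exact ⟨fun hw => hR.trans (hR.symm h) hw, fun hw => hR.trans h hw⟩

theorem func_rel {n : ℕ} {f : L.Functions n} {us vs : Fin n → GroundTerm L}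
    (hu : .func f us ∈ T) (hv : .func f vs ∈ T) {ρ : Equiv.Perm (Fin n)} (hρ : Allowed perms f ρ)
    (h : ∀ i, (us i, vs (ρ i)) ∈ R) :
    ((.func f us : GroundTerm L), (.func f vs : GroundTerm L)) ∈ R := by
  refine (hR.mem_iff _ _).2 ⟨hu, hv, ?_⟩
  simp only [step, Bool.or_eq_true, List.any_eq_true, Bool.and_eq_true, decide_eq_true_eq, sym]
  rcases hρ with rfl | hρ
  · refine .inr (.inr (.inr (.inl ⟨trivial, ?_⟩)))
    simp only [args, allRel_ofFn, rel_iff]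
    exact h
  · refine .inr (.inr (.inr (.inr (.inl ⟨_, hρ, by simp, by simp, ?_⟩))))
    simp only [args, permList_ofFn, allRel_ofFn, rel_iff]
    exact h

theorem symbol_rel {g : L.Functions 2} {p : InterpretedBy L} (hp : (g, p) ∈ ints)
    {ts : Fin 2 → GroundTerm L} {v : GroundTerm L} (hu : .func g ts ∈ T) (hv : v ∈ T)
    (h : symbolStep p R (.func g ts) v = true) : ((.func g ts : GroundTerm L), v) ∈ R := by
  refine (hR.mem_iff _ _).2 ⟨hu, hv, ?_⟩
  simp only [step, Bool.or_eq_true, List.any_eq_true, Bool.and_eq_true, decide_eq_true_eq, sym]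
  exact .inr (.inr (.inr (.inr (.inr ⟨_, hp, by simp, h⟩))))

variable (hE : IsPermList E perms)
include hE

/-- Two matches of `x`, up to `ρ` and `τ`, have related arguments up to `ρ⁻¹ * τ`. This permutation
is allowed, so the closure relates the two terms. -/
theorem modelFun_eq {n : ℕ} {f : L.Functions n} {x : Fin n → Set (GroundTerm L)}
    {ts : Fin n → GroundTerm L} (h : IsMatch perms T R f x ts) :
    modelFun perms B T R f x = cls R (.func f ts) := by
  have h' : ∃ ts, IsMatch perms T R f x ts := ⟨ts, h⟩
  rw [modelFun, dif_pos h']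
  obtain ⟨h₁, τ, hτ, h₂⟩ := h'.choose_spec
  obtain ⟨h₃, ρ, hρ, h₄⟩ := h
  refine (hR.cls_eq_iff h₃).2 (hR.func_rel h₁ h₃ ((hρ.inv hE).mul hE hτ) fun i => ?_)
  rw [← hR.cls_eq_iff (hR.arg_mem h₃ _), h₂, h₄]
  simp [Equiv.Perm.inv_def]

theorem modelFun_func {n : ℕ} {f : L.Functions n} {ts : Fin n → GroundTerm L}
    (h : .func f ts ∈ T) :
    modelFun perms B T R f (fun i => cls R (ts i)) = cls R (.func f ts) :=
  hR.modelFun_eq hE ⟨h, 1, .inl rfl, fun _ => rfl⟩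

/-- As `T` is closed under arguments, the evaluation never leaves the partial algebra of classes. -/
theorem eval_ground (v : ℕ → Set (GroundTerm L)) : ∀ {t : GroundTerm L}, t ∈ T →
    eval (modelFun perms B T R) v (toTerm t) = cls R t
  | .var a, _ => a.elim
  | .func f ts, h => by
    rw [toTerm_func, eval, ← hR.modelFun_func hE h]
    exact congrArg _ (funext fun i => eval_ground v (hR.arg_mem h i))

/-- Permuting `x` keeps the matching terms and only shifts the permutations that witness the match.
So both sides come from one match, or both are the symmetric default. -/
theorem modelFun_perm {n : ℕ} {f : L.Functions n} {ρ : Equiv.Perm (Fin n)}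
    (hρ : Allowed perms f ρ) (x : Fin n → Set (GroundTerm L)) :
    modelFun perms B T R f (fun i => x (ρ i)) = modelFun perms B T R f x := by
  by_cases h : ∃ ts, IsMatch perms T R f x ts
  · obtain ⟨ts, h⟩ := h
    rw [hR.modelFun_eq hE h]
    obtain ⟨h₁, τ, hτ, h₂⟩ := h
    exact hR.modelFun_eq hE ⟨h₁, ρ⁻¹ * τ, (hρ.inv hE).mul hE hτ, fun i => by
      simp [h₂, Equiv.Perm.inv_def]⟩
  · have h' : ¬ ∃ ts, IsMatch perms T R f (fun i => x (ρ i)) ts := by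
      rintro ⟨ts, h₁, τ, hτ, h₂⟩
      exact h ⟨ts, h₁, ρ * τ, hρ.mul hE hτ, h₂⟩
    rw [modelFun, modelFun, dif_neg h, dif_neg h', defaultVal_perm]

theorem eval_perm {e : Equation L} (he : e ∈ E) (hp : IsPermutationEquation e)
    (v : ℕ → Set (GroundTerm L)) :
    eval (modelFun perms B T R) v e.1 = eval (modelFun perms B T R) v e.2 := by
  obtain ⟨n, f, ρ, x, hx, rfl⟩ := hp
  have hρ : Allowed perms f ρ := .inr ((hE _).2 ⟨⟨_, he, _, rfl⟩, .of_mem hx he⟩)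
  exact (hR.modelFun_perm hE hρ fun i => v (x i)).symm

section interpreted
variable (hints : ∀ c, c ∈ ints ↔ B c.1 = some c.2) {g : L.Functions 2} {p : InterpretedBy L}
include hints

theorem eval_const {z : L.Constants} (hp : B g = some p) (hz : z.term ∈ p.constants)
    (v : ℕ → Set (GroundTerm L)) :
    eval (modelFun perms B T R) v (z.term : L.Term ℕ) = cls R z.term := by
  rw [← toTerm_term, hR.eval_ground hE]
  exact hR.const_mem _ ((hints (g, p)).2 hp) _ hz

/-- The value of an interpreted symbol is given by one of its rules or by default. -/
theorem modelFun_symbol (hp : B g = some p) (x y : Set (GroundTerm L)) {m : Set (GroundTerm L)}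
    (hm : symbolVal R p x y = m)
    -- A match fixes the classes of the two arguments only up to order, so the rule has to apply in
    -- both orders.
    (hstep : ∀ ts : Fin 2 → GroundTerm L, (∀ i, ts i ∈ T) →
      (cls R (ts 0) = x ∧ cls R (ts 1) = y ∨ cls R (ts 0) = y ∧ cls R (ts 1) = x) →
      ∃ v ∈ T, cls R v = m ∧ symbolStep p R (.func g ts) v = true) :
    modelFun perms B T R g ![x, y] = m := by
  by_cases h : ∃ ts, IsMatch perms T R g ![x, y] ts
  · obtain ⟨ts, h⟩ := h
    rw [hR.modelFun_eq hE h]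
    obtain ⟨h₁, ρ, hρ, h₂⟩ := h
    have h₃ : cls R (ts 0) = x ∧ cls R (ts 1) = y ∨ cls R (ts 0) = y ∧ cls R (ts 1) = x := by
      have h₄ : ∀ i j : Fin 2, i ≠ j → (![x, y] i = x ∧ ![x, y] j = y) ∨
          (![x, y] i = y ∧ ![x, y] j = x) := by
        intro i j hij
        fin_cases i <;> fin_cases j <;> simp_all
      rw [h₂, h₂]
      exact h₄ _ _ fun h => by simpa using ρ.injective h
    obtain ⟨v, hv, hv', hs⟩ := hstep ts (hR.arg_mem h₁) h₃
    rw [← hv', hR.cls_eq_iff hv]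
    exact hR.symbol_rel ((hints (g, p)).2 hp) h₁ hv hs
  · rw [modelFun, dif_neg h]
    simpa [defaultVal, hp] using hm

theorem eval_symbolRules (hp : B g = some p) {e : Equation L} (he : e ∈ symbolRules g p)
    (v : ℕ → Set (GroundTerm L)) :
    eval (modelFun perms B T R) v e.1 = eval (modelFun perms B T R) v e.2 := by
  have hrel : ∀ {a b : GroundTerm L}, b ∈ T → cls R a = cls R b → (a, b) ∈ R :=
    fun hb h => (hR.cls_eq_iff hb).1 h
  have hconst : ∀ {z : L.Constants}, z.term ∈ p.constants → z.term ∈ T :=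
    fun hz => hR.const_mem _ ((hints (g, p)).2 hp) _ hz
  have hi : (∀ u v, idemStep R u v = true → symbolStep p R u v = true) →
      (∀ x, symbolVal R p x x = x) → e ∈ idemRules g →
      eval (modelFun perms B T R) v e.1 = eval (modelFun perms B T R) v e.2 := by
    rintro hstep hval rfl
    rw [eval_apply₂]
    refine hR.modelFun_symbol hE hints hp _ _ (hval _) fun ts hts h => ⟨ts 0, hts 0, ?_, ?_⟩
    · exact h.elim (fun h => h.1) fun h => h.1
    · refine hstep _ _ (idemStep_iff.2 ⟨hR.refl (hts 0), hrel (hts 0) ?_⟩)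
      rcases h with h | h <;> rw [h.1, h.2]
  have hn : ∀ z : L.Constants, z.term ∈ p.constants →
      (∀ u v, nilpStep z R u v = true → symbolStep p R u v = true) →
      (∀ x, symbolVal R p x x = cls R z.term) → e ∈ nilpRules g z →
      eval (modelFun perms B T R) v e.1 = eval (modelFun perms B T R) v e.2 := by
    rintro z hz hstep hval rfl
    rw [eval_apply₂, hR.eval_const hE hints hp hz]
    refine hR.modelFun_symbol hE hints hp _ _ (hval _) fun ts hts h =>
      ⟨z.term, hconst hz, rfl, ?_⟩
    refine hstep _ _ (nilpStep_iff.2 ⟨hrel (hts 1) ?_, rfl⟩)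
    rcases h with h | h <;> rw [h.1, h.2]
  have hu : ∀ z : L.Constants, z.term ∈ p.constants →
      (∀ u v, unitStep z R u v = true → symbolStep p R u v = true) →
      (∀ x, symbolVal R p x (cls R z.term) = x) → e ∈ unitRules g z →
      eval (modelFun perms B T R) v e.1 = eval (modelFun perms B T R) v e.2 := by
    intro z hz hstep hval he
    have key : ∀ (ts : Fin 2 → GroundTerm L) (x : Set (GroundTerm L)), (∀ i, ts i ∈ T) →
        (cls R (ts 0) = x ∧ cls R (ts 1) = cls R z.term ∨
          cls R (ts 0) = cls R z.term ∧ cls R (ts 1) = x) →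
        ∃ v ∈ T, cls R v = x ∧ symbolStep p R (.func g ts) v = true := by
      rintro ts x hts (⟨h₀, h₁⟩ | ⟨h₀, h₁⟩)
      · exact ⟨ts 0, hts 0, h₀, hstep _ _ (unitStep_iff.2
          (.inl ⟨hR.refl (hts 0), hrel (hconst hz) h₁⟩))⟩
      · exact ⟨ts 1, hts 1, h₁, hstep _ _ (unitStep_iff.2
          (.inr ⟨hrel (hconst hz) h₀, hR.refl (hts 1)⟩))⟩
    rcases he with rfl | rfl
    · rw [eval_apply₂, hR.eval_const hE hints hp hz]
      exact hR.modelFun_symbol hE hints hp _ _ (hval _) fun ts hts h => key ts _ hts h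
    · rw [eval_apply₂, hR.eval_const hE hints hp hz]
      exact hR.modelFun_symbol hE hints hp _ _ ((symbolVal_comm R p _ _).trans (hval _))
        fun ts hts h => key ts _ hts h.symm
  have hval : ∀ z x d : Set (GroundTerm L), unitVal z x z d = x := fun z x d => by
    simp only [unitVal, ifEq]
    split_ifs with h <;> simp_all
  rcases p with _ | z | z | z | z
  · exact hi (fun _ _ h => h) (fun x => by simp [symbolVal, ifEq]) he
  · exact hn z (by simp [InterpretedBy.constants]) (fun _ _ h => h)
      (fun x => by simp [symbolVal, ifEq]) he
  · exact hu z (by simp [InterpretedBy.constants]) (fun _ _ h => h) (fun x => hval _ _ _) he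
  · rcases he with he | he
    · exact hi (fun _ _ h => Bool.or_eq_true _ _ ▸ .inl h)
        (fun x => by simp only [symbolVal, unitVal, ifEq]; split_ifs <;> simp_all) he
    · exact hu z (by simp [InterpretedBy.constants])
        (fun _ _ h => Bool.or_eq_true _ _ ▸ .inr h) (fun x => hval _ _ _) he
  · rcases he with he | he
    · exact hn z (by simp [InterpretedBy.constants]) (fun _ _ h => Bool.or_eq_true _ _ ▸ .inl h)
        (fun x => by simp only [symbolVal, unitVal, ifEq]; split_ifs <;> simp_all) he
    · exact hu z (by simp [InterpretedBy.constants])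
        (fun _ _ h => Bool.or_eq_true _ _ ▸ .inr h) (fun x => hval _ _ _) he

/-- Terms of `T` that are equal modulo the theory are related by the closure. -/
theorem complete (hE' : ∀ e ∈ E, IsPermutationEquation e) (hP : ∀ e ∈ P, e.1 ∈ T ∧ e.2 ∈ T)
    {s t : GroundTerm L} (hs : s ∈ T) (ht : t ∈ T)
    (h : EqTheory ({e | ∃ p ∈ P, e = (toTerm p.1, toTerm p.2)} ∪ E ∪ rules B) (toTerm s)
      (toTerm t)) : (s, t) ∈ R := by
  have h₁ := h.eval_eq (modelFun perms B T R) (by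
    rintro e ((⟨p, hp, rfl⟩ | he) | ⟨g, p, hp, he⟩) v
    · rw [hR.eval_ground hE _ (hP p hp).1, hR.eval_ground hE _ (hP p hp).2,
        hR.cls_eq_iff (hP p hp).2]
      refine (hR.mem_iff _ _).2 ⟨(hP p hp).1, (hP p hp).2, ?_⟩
      simp only [step, Bool.or_eq_true, rel_iff]
      exact .inr (.inr (.inl hp))
    · exact hR.eval_perm hE he (hE' e he) v
    -- The valuation is irrelevant because `s` and `t` are ground.
    · exact hR.eval_symbolRules hE hints hp he v) fun _ => ∅
  rwa [hR.eval_ground hE _ hs, hR.eval_ground hE _ ht, hR.cls_eq_iff ht] at h₁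

end interpreted

end IsClosure

end model

/-- The terms on which the congruence closure of an input is computed. -/
def inputTerms (ints : List (L.Functions 2 × InterpretedBy L)) (w : Input L) :
    List (GroundTerm L) :=
  ((w.s, w.t) :: w.P).flatMap (fun p => subterms p.1 ++ subterms p.2) ++
    -- The rules test against these constants, so they must lie in `T` even if absent from the
    -- input; being fixed, they add only a constant size.
    ints.flatMap fun c => c.2.constants.flatMap subterms

open Classical in
/-- The congruence closure decides the word problem. -/
theorem wordProblem_eq {E : Set (Equation L)} {B : L.Functions 2 → Option (InterpretedBy L)}
    {perms : List (PermRule L)} {ints : List (L.Functions 2 × InterpretedBy L)}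
    (hE : IsPermList E perms) (hE' : ∀ e ∈ E, IsPermutationEquation e)
    (hints : ∀ c, c ∈ ints ↔ B c.1 = some c.2) (w : Input L) :
    wordProblem E B w = rel (closure perms ints (inputTerms ints w) w.P) w.s w.t := by
  have hR : IsClosure perms ints (inputTerms ints w) w.P
      (closure perms ints (inputTerms ints w) w.P) := by
    refine ⟨fun u v => mem_closure_iff, fun {n f ts} h i => ?_, fun c hc z hz => ?_⟩
    · simp only [inputTerms, List.mem_append, List.mem_flatMap] at h ⊢
      rcases h with ⟨p, hp, h | h⟩ | ⟨c, hc, z, hz, h⟩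
      · exact .inl ⟨p, hp, .inl (mem_subterms_of_func i h)⟩
      · exact .inl ⟨p, hp, .inr (mem_subterms_of_func i h)⟩
      · exact .inr ⟨c, hc, z, hz, mem_subterms_of_func i h⟩
    · simp only [inputTerms, List.mem_append, List.mem_flatMap]
      exact .inr ⟨c, hc, z, hz, mem_subterms_self z⟩
  have hmem : ∀ p ∈ (w.s, w.t) :: w.P, p.1 ∈ inputTerms ints w ∧ p.2 ∈ inputTerms ints w := by
    intro p hp
    simp only [inputTerms, List.mem_append, List.mem_flatMap]
    exact ⟨.inl ⟨p, hp, .inl (mem_subterms_self _)⟩, .inl ⟨p, hp, .inr (mem_subterms_self _)⟩⟩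
  rw [Bool.eq_iff_iff, rel_iff, wordProblem, decide_eq_true_eq]
  constructor
  · exact hR.complete hE hints hE' (fun p hp => hmem p (.tail _ hp)) (hmem _ (.head _)).1
      (hmem _ (.head _)).2
  · exact closure_sound (S := w.equations ∪ E ∪ rules B)
      (Set.subset_union_right.trans Set.subset_union_left) Set.subset_union_right
      (fun c hc => ((hE c).1 hc).2) (fun c hc => (hints c).1 hc)
      (fun p hp => .base (.inl (.inl ⟨p, hp, rfl⟩))) _ _

/-! ### Polynomial running time of the closure. -/

/-- A naming of the function symbols by binary strings. -/
class Naming (L : FirstOrder.Language.{0, 0}) where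
  name : (Σ n, L.Functions n) → List Bool
  inj : Function.Injective name

section encodings

variable {L : FirstOrder.Language.{0, 0}} [Naming L]

instance : Enc (Σ n, L.Functions n) := ⟨fun f => Enc.enc (Naming.name f)⟩

instance : LawfulEnc (Σ n, L.Functions n) := ⟨fun _ _ h => Naming.inj (LawfulEnc.inj h)⟩

/-- The encoding of ground terms. -/
def encTerm : GroundTerm L → BTree
  | .var a => a.elim
  | .func (l := n) f ts =>
      .node (Enc.enc (⟨n, f⟩ : Σ n, L.Functions n)) (Enc.enc (List.ofFn fun i => encTerm (ts i)))

instance : Enc (GroundTerm L) := ⟨encTerm⟩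

/-- This lets the parser build raw trees without knowing the function symbols: a list of codes has
the same encoding as the list of the objects themselves. -/
theorem enc_map_enc {α : Type} [Enc α] (l : List α) :
    Enc.enc (l.map Enc.enc : List BTree) = Enc.enc l := by
  induction l with
  | nil => rfl
  | cons x l ih => rw [List.map_cons, enc_cons, enc_cons, ih]; rfl

/-- A term and the pair of its symbol and arguments have the same encoding, so taking terms apart
reduces to the projections of a pair. -/
theorem enc_sym_args : ∀ t : GroundTerm L, Enc.enc (sym t, args t) = Enc.enc t
  | .var a => a.elim
  | .func f ts => by
    rw [enc_mk, args, ← enc_map_enc, List.map_ofFn]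
    rfl

instance : LawfulEnc (GroundTerm L) := ⟨fun s => by
  induction s with
  | var a => exact a.elim
  | func f ts ih =>
    intro t h
    rcases t with a | ⟨g, us⟩
    · exact a.elim
    rw [← enc_sym_args, ← enc_sym_args (.func g us), enc_mk, enc_mk, BTree.node.injEq] at h
    have h₁ := LawfulEnc.inj h.1
    simp only [sym] at h₁
    cases h₁
    have h₂ := h.2
    rw [← enc_map_enc, ← enc_map_enc (args _)] at h₂
    have h₃ := LawfulEnc.inj h₂
    simp only [args, List.map_ofFn] at h₃
    have h₄ := List.ofFn_injective h₃
    congr 1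
    funext i
    exact ih i (congrFun h₄ i)⟩

end encodings

theorem sz_le_of_sublist {α : Type} [Enc α] {l l' : List α} (h : List.Sublist l' l) :
    sz l' ≤ sz l := by
  induction h with
  | slnil => rfl
  | cons x _ ih => simp; omega
  | cons_cons x _ ih => simp; omega

namespace PolyTime

section algorithm

variable {L : FirstOrder.Language.{0, 0}} [Naming L] {α β : Type} [Enc α] [Enc β]
  {T : α → List (GroundTerm L)} {P R : α → List (GroundTerm L × GroundTerm L)}
  {u v : α → GroundTerm L}

theorem sym (hu : PolyTime u) : PolyTime fun x => PermWord.sym (u x) :=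
  PolyTime.comp (f := PermWord.sym) ((fst (α := Σ n, L.Functions n) (β := List (GroundTerm L))).of_enc_eq
    (fun t => (PermWord.sym t, PermWord.args t)) enc_sym_args fun _ => rfl) hu

theorem args (hu : PolyTime u) : PolyTime fun x => PermWord.args (u x) :=
  PolyTime.comp (f := PermWord.args) ((snd (α := Σ n, L.Functions n) (β := List (GroundTerm L))).of_enc_eq
    (fun t => (PermWord.sym t, PermWord.args t)) enc_sym_args fun _ => rfl) hu

open Classical in
theorem rel [LawfulEnc β] {R : α → List (β × β)} {u v : α → β} (hR : PolyTime R) (hu : PolyTime u)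
    (hv : PolyTime v) : PolyTime fun x => PermWord.rel (R x) (u x) (v x) :=
  (hu.pair hv).mem hR

theorem permList {l : α → List β} (hl : PolyTime l) {n : ℕ} (ρ : Equiv.Perm (Fin n)) :
    PolyTime fun x => permList ρ (l x) :=
  flatMap_const _ fun i => (hl.drop (ρ i)).take_one

theorem allRel_rel [LawfulEnc β] {R : α → List (β × β)} {us vs : α → List β} (hR : PolyTime R)
    (hu : PolyTime us) (hv : PolyTime vs) :
    PolyTime fun x => PermWord.allRel (PermWord.rel (R x)) (us x) (vs x) :=
  hu.allRel hv (r := fun x => PermWord.rel (R x))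
    ((hR.comp fst).rel (fst.comp snd) (snd.comp snd))

theorem idemStep (hR : PolyTime R) (hu : PolyTime u) (hv : PolyTime v) :
    PolyTime fun x => idemStep (R x) (u x) (v x) :=
  hR.allRel_rel hu.args (hv.cons (hv.cons (const [])))

open Classical in
theorem nilpStep (hR : PolyTime R) (hu : PolyTime u) (hv : PolyTime v) (z : L.Constants) :
    PolyTime fun x => nilpStep z (R x) (u x) (v x) :=
  (hR.allRel_rel hu.args.take_one hu.args.tail).and (hv.eq (const _))

theorem unitStep (hR : PolyTime R) (hu : PolyTime u) (hv : PolyTime v) (z : L.Constants) :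
    PolyTime fun x => unitStep z (R x) (u x) (v x) :=
  (hR.allRel_rel hu.args (hv.cons (const [z.term]))).or
    (hR.allRel_rel hu.args ((const z.term).cons (hv.cons (const []))))

theorem symbolStep (hR : PolyTime R) (hu : PolyTime u) (hv : PolyTime v) :
    ∀ p : InterpretedBy L, PolyTime fun x => symbolStep p (R x) (u x) (v x)
  | .idem => hR.idemStep hu hv
  | .nilp z => hR.nilpStep hu hv z
  | .unit z => hR.unitStep hu hv z
  | .idemUnit z => (hR.idemStep hu hv).or (hR.unitStep hu hv z)
  | .nilpUnit z => (hR.nilpStep hu hv z).or (hR.unitStep hu hv z)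

variable (perms : List (PermRule L)) (ints : List (L.Functions 2 × InterpretedBy L))

open Classical in
theorem step (hT : PolyTime T) (hP : PolyTime P) (hR : PolyTime R) (hu : PolyTime u)
    (hv : PolyTime v) : PolyTime fun x => step perms ints (T x) (P x) (R x) (u x) (v x) :=
  (hu.eq hv).or (((hT.any (p := fun x w => PermWord.rel (R x) (u x) w && PermWord.rel (R x) (v x) w)
    (((hR.comp fst).rel (hu.comp fst) snd).and ((hR.comp fst).rel (hv.comp fst) snd)))).or
    ((hP.rel hu hv).or (((hu.sym.eq hv.sym).and (hR.allRel_rel hu.args hv.args)).or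
    ((any_const perms fun c => (hu.sym.eq (const c.1)).and ((hv.sym.eq (const c.1)).and
      (hR.allRel_rel hu.args (hv.args.permList c.2)))).or
    (any_const ints fun c => (hu.sym.eq (const ⟨2, c.1⟩)).and (hR.symbolStep hu hv c.2))))))

theorem pairs {l : α → List β} (hl : PolyTime l) : PolyTime fun x => pairs (l x) :=
  hl.flatMap (f := fun x u => (l x).map fun v => (u, v))
    ((hl.comp fst).map (f := fun (y : α × β) v => (y.2, v)) ((snd.comp fst).pair snd))

theorem next (hT : PolyTime T) (hP : PolyTime P) (hR : PolyTime R) :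
    PolyTime fun x => next perms ints (T x) (P x) (R x) :=
  hT.pairs.filter (p := fun x (y : GroundTerm L × GroundTerm L) => PermWord.step perms ints (T x) (P x) (R x) y.1 y.2)
    (step (u := fun y : α × (GroundTerm L × GroundTerm L) => y.2.1) (v := fun y => y.2.2)
      perms ints (hT.comp fst) (hP.comp fst) (hR.comp fst) (fst.comp snd) (snd.comp snd))

theorem closure (hT : PolyTime T) (hP : PolyTime P) :
    PolyTime fun x => closure perms ints (T x) (P x) := by
  obtain ⟨q, hq⟩ := hT.pairs.exists_sz_le
  refine foldl (f := fun y : α × (GroundTerm L × GroundTerm L) × List (GroundTerm L × GroundTerm L) =>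
    PermWord.next perms ints (T y.1) (P y.1) y.2.2) hT.pairs (const [])
    (next perms ints (hT.comp fst) (hP.comp fst) (snd.comp snd)) q fun x l' _ => ?_
  refine le_trans ?_ (hq x)
  -- After at least one round the relation is a sublist of the pairs of `T`, so its size is bounded
  -- independently of the number of rounds.
  rcases l'.eq_nil_or_concat with rfl | ⟨l, b, rfl⟩
  · exact one_le_sz _
  · rw [List.concat_eq_append, List.foldl_append]
    exact sz_le_of_sublist List.filter_sublist

end algorithm

end PolyTime

/-! ### Parsing the input. -/

instance : Enc Letter := ⟨fun
  | .lp => Enc.enc (false, false)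
  | .rp => Enc.enc (false, true)
  | .bit b => Enc.enc (true, b)⟩

/-- The bits that encode a letter. -/
def Letter.bits : Letter → Bool × Bool
  | .lp => (false, false)
  | .rp => (false, true)
  | .bit b => (true, b)

theorem enc_bits (a : Letter) : Enc.enc a.bits = Enc.enc a := by cases a <;> rfl

theorem sz_letter_le (a : Letter) : sz a ≤ 7 := by
  rcases a with _ | _ | _ | _ <;> decide

/-- The state of the parser, which reads its input from right to left: the stack of the incomplete
terms (with arguments and name), and the list of the complete terms. -/
abbrev ParserState : Type := List (List BTree × List Bool) × List BTree

/-- A transition of the parser. -/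
def parseStep : Letter → ParserState → ParserState
  -- Reading from the right, the name and the arguments arrive in reverse, so prepending restores
  -- their order; an opening parenthesis completes the term.
  | .lp, (f :: f' :: fs, all) =>
    ((Enc.enc (f.2, f.1) :: f'.1, f'.2) :: fs, Enc.enc (f.2, f.1) :: all)
  | .lp, s => s
  | .rp, (fs, all) => (([], []) :: fs, all)
  | .bit b, (f :: fs, all) => ((f.1, b :: f.2) :: fs, all)
  | .bit _, ([], all) => ([], all)

/-- A letter adds at most a constant to the stack, as an opening parenthesis only moves a finished
term into its parent. The list of complete terms gains at most one term, no larger than the stack.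
The total growth is thus quadratic. -/
theorem sz_parseStep (a : Letter) (s : ParserState) :
    sz (parseStep a s).1 ≤ sz s.1 + 4 ∧ sz (parseStep a s).2 ≤ sz s.2 + sz s.1 := by
  have h : ∀ x : List Bool × List BTree, sz (Enc.enc x) = sz x := fun x => rfl
  have h₁ : ∀ x : List BTree × List Bool, sz x = sz x.1 + sz x.2 + 1 := fun x => rfl
  rcases a with _ | _ | b
  · rcases s with ⟨_ | ⟨f, _ | ⟨f', fs⟩⟩, all⟩
    · simp [parseStep]
    · simp [parseStep]
    · simp only [parseStep, sz_cons, sz_mk, h, h₁]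
      omega
  · rcases s with ⟨fs, all⟩
    simp [parseStep]
    omega
  · rcases s with ⟨_ | ⟨f, fs⟩, all⟩
    · simp [parseStep]
    · have := sz_bool_le b
      simp only [parseStep, sz_cons, h₁]
      omega

/-- Parse a reversed word. -/
def parse (l : List Letter) : ParserState :=
  -- The bottom frame is never closed; it collects the top-level terms of the input.
  l.foldl (fun s a => parseStep a s) ([([], [])], [])

theorem sz_foldl_parseStep (l : List Letter) (s : ParserState) :
    sz (l.foldl (fun s a => parseStep a s) s).1 ≤ sz s.1 + 4 * l.length ∧
    sz (l.foldl (fun s a => parseStep a s) s).2 ≤ sz s.2 + l.length * (sz s.1 + 4 * l.length) := by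
  induction l generalizing s with
  | nil => simp
  | cons a l ih =>
    obtain ⟨h₁, h₂⟩ := ih (parseStep a s)
    obtain ⟨h₃, h₄⟩ := sz_parseStep a s
    simp only [List.foldl_cons, List.length_cons]
    constructor
    · omega
    · have : l.length * (sz (parseStep a s).1 + 4 * l.length) ≤
          l.length * (sz s.1 + 4 * (l.length + 1)) := Nat.mul_le_mul_left _ (by omega)
      rw [Nat.succ_mul]
      omega

theorem PolyTime.encode {α β : Type} [Enc α] [Enc β] {f : α → β} (hf : PolyTime f) :
    PolyTime fun x => (Enc.enc (f x) : BTree) :=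
  (PolyTime.of_enc (f := (Enc.enc : β → BTree)) fun _ => rfl).comp hf

theorem polyTime_parseStep : PolyTime fun y : Letter × ParserState => parseStep y.1 y.2 := by
  have hbits : PolyTime fun y : Letter × ParserState => y.1.bits :=
    (PolyTime.of_enc enc_bits).comp .fst
  have hpush : PolyTime fun y : (List BTree × List Bool) × List (List BTree × List Bool) ×
      (Letter × ParserState) => (((y.1.1, y.2.2.1.bits.2 :: y.1.2) :: y.2.1, y.2.2.2.2) :
        ParserState) :=
    (((PolyTime.fst.comp .fst).pair
      ((PolyTime.snd.comp (hbits.comp (.comp .snd .snd))).cons (PolyTime.snd.comp .fst))).cons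
      (PolyTime.fst.comp .snd)).pair (PolyTime.snd.comp (PolyTime.snd.comp (PolyTime.snd.comp .snd)))
  have hterm : PolyTime fun y : (List BTree × List Bool) × List (List BTree × List Bool) ×
      ((List BTree × List Bool) × List (List BTree × List Bool) × (Letter × ParserState)) =>
      (Enc.enc (y.2.2.1.2, y.2.2.1.1) : BTree) :=
    PolyTime.encode ((PolyTime.snd.comp (PolyTime.fst.comp (PolyTime.snd.comp .snd))).pair
      (PolyTime.fst.comp (PolyTime.fst.comp (PolyTime.snd.comp .snd))))
  have hreduce : PolyTime fun y : (List BTree × List Bool) × List (List BTree × List Bool) ×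
      ((List BTree × List Bool) × List (List BTree × List Bool) × (Letter × ParserState)) =>
      (((Enc.enc (y.2.2.1.2, y.2.2.1.1) :: y.1.1, y.1.2) :: y.2.1,
        Enc.enc (y.2.2.1.2, y.2.2.1.1) :: y.2.2.2.2.2.2) : ParserState) :=
    (((hterm.cons (PolyTime.fst.comp .fst)).pair (PolyTime.snd.comp .fst)).cons
      (PolyTime.fst.comp .snd)).pair
      (hterm.cons (PolyTime.snd.comp (PolyTime.snd.comp (PolyTime.snd.comp (PolyTime.snd.comp
        (PolyTime.snd.comp .snd))))))
  have h := PolyTime.ite (PolyTime.fst.comp hbits)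
    (PolyTime.listCases (PolyTime.fst.comp .snd) .snd hpush)
    (PolyTime.ite (PolyTime.snd.comp hbits)
      (((PolyTime.const ([], [])).cons (PolyTime.fst.comp .snd)).pair (PolyTime.snd.comp .snd))
      (PolyTime.listCases (PolyTime.fst.comp .snd) .snd
        (PolyTime.listCases (PolyTime.fst.comp .snd)
          (PolyTime.snd.comp (PolyTime.snd.comp .snd)) hreduce)))
  refine h.of_eq fun y => ?_
  rcases y with ⟨_ | _ | b, ⟨_ | ⟨f, _ | ⟨f', fs⟩⟩, all⟩⟩ <;> rfl

theorem polyTime_parse : PolyTime parse := by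
  refine PolyTime.foldl_aux (l := fun l : List Letter => l) (f := fun y => parseStep y.1 y.2) .id
    (.const _) polyTime_parseStep ((5 + 4 * .X) + (1 + .X * (5 + 4 * .X)) + 1) fun l l' hl' => ?_
  obtain ⟨h₁, h₂⟩ := sz_foldl_parseStep l' ([([], [])], [])
  have h₃ := hl'.length_le.trans (length_le_sz l)
  have h₄ : ∀ s : ParserState, sz s = sz s.1 + sz s.2 + 1 := fun _ => rfl
  have h₅ : l'.length * (5 + 4 * l'.length) ≤ sz l * (5 + 4 * sz l) := by gcongr
  rw [h₄]
  simp only [Polynomial.eval_add, Polynomial.eval_mul, Polynomial.eval_X, Polynomial.eval_ofNat,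
    Polynomial.eval_one]
  simp only [sz_cons, sz_nil, sz_mk, Nat.reduceAdd] at h₁ h₂
  omega

section parse

variable {L : FirstOrder.Language.{0, 0}} [Naming L]

theorem foldr_parseStep_bits (l : List Bool) (cs : List BTree) (nm : List Bool)
    (fs : List (List BTree × List Bool)) (all : List BTree) :
    (l.map Letter.bit).foldr parseStep ((cs, nm) :: fs, all) = ((cs, l ++ nm) :: fs, all) := by
  induction l with
  | nil => rfl
  | cons b l ih => rw [List.map_cons, List.foldr_cons, ih]; rfl

theorem foldr_parseStep_flatten {ι : Type} (e : ι → List Letter) (t : ι → BTree)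
    (sub : ι → List BTree) (l : List ι)
    (h : ∀ i ∈ l, ∀ cs nm fs all, (e i).foldr parseStep ((cs, nm) :: fs, all) =
      ((t i :: cs, nm) :: fs, sub i ++ all))
    (cs : List BTree) (nm : List Bool) (fs : List (List BTree × List Bool)) (all : List BTree) :
    (l.flatMap e).foldr parseStep ((cs, nm) :: fs, all) =
      ((l.map t ++ cs, nm) :: fs, l.flatMap sub ++ all) := by
  induction l with
  | nil => rfl
  | cons i l ih =>
    rw [List.flatMap_cons, List.foldr_append, ih fun j hj => h j (by simp [hj]),
      h i (by simp)]
    simp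

/-- The surrounding frames are arbitrary so that the induction applies to arguments inside a newly
opened frame. Terms are recorded when completed from the right, which yields exactly the order of
`subterms`. -/
theorem foldr_parseStep_encodeTerm (t : GroundTerm L) :
    ∀ (cs : List BTree) (nm : List Bool) (fs : List (List BTree × List Bool)) (all : List BTree),
    (encodeTerm Naming.name t).foldr parseStep ((cs, nm) :: fs, all) =
      ((Enc.enc t :: cs, nm) :: fs, (subterms t).map Enc.enc ++ all) := by
  induction t with
  | var a => exact a.elim
  | @func n f ts ih =>
    intro cs nm fs all
    have h := foldr_parseStep_flatten (fun i => encodeTerm Naming.name (ts i))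
      (fun i => Enc.enc (ts i)) (fun i => (subterms (ts i)).map Enc.enc) (List.finRange n)
      (fun i _ => ih i) [] [] ((cs, nm) :: fs) all
    have e : ∀ {β : Type} (g : Fin n → List β), (List.ofFn g).flatten = (List.finRange n).flatMap g :=
      fun g => by rw [List.ofFn_eq_map, List.flatMap]
    have ht : Enc.enc (Naming.name (⟨n, f⟩ : Σ n, L.Functions n) ++ [],
        (List.finRange n).map (fun i => Enc.enc (ts i)) ++ []) = Enc.enc (.func f ts : GroundTerm L) := by
      rw [List.append_nil, List.append_nil, ← List.ofFn_eq_map]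
      rfl
    simp only [encodeTerm, subterms, List.foldr_cons, List.foldr_append, List.foldr_nil, e]
    rw [show parseStep .rp ((cs, nm) :: fs, all) = (([], []) :: (cs, nm) :: fs, all) from rfl, h,
      foldr_parseStep_bits]
    simp only [parseStep, ht, List.map_cons, List.map_flatMap, List.cons_append]

/-- The terms of an input, in the order in which they are written. -/
def Input.terms (w : Input L) : List (GroundTerm L) :=
  ((w.s, w.t) :: w.P).flatMap fun p => [p.1, p.2]

theorem encodeInput_eq (w : Input L) :
    encodeInput Naming.name w = w.terms.flatMap (encodeTerm Naming.name) := by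
  have h : ∀ P : List (GroundTerm L × GroundTerm L),
      (P.map fun p => encodeTerm Naming.name p.1 ++ encodeTerm Naming.name p.2).flatten =
      (P.flatMap fun p => [p.1, p.2]).flatMap (encodeTerm Naming.name) := by
    intro P
    induction P with
    | nil => rfl
    | cons p P ih => simp [ih]
  simp [encodeInput, Input.terms, h]

theorem parse_encodeInput (w : Input L) : parse (encodeInput Naming.name w).reverse =
    ([(w.terms.map Enc.enc, [])], (w.terms.flatMap subterms).map Enc.enc) := by
  have h := foldr_parseStep_flatten (encodeTerm (L := L) Naming.name) Enc.enc
    (fun t => (subterms t).map Enc.enc) w.terms (fun t _ => foldr_parseStep_encodeTerm t) [] [] [] []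
  rw [parse, List.foldl_reverse, encodeInput_eq]
  refine h.trans ?_
  rw [List.append_nil, List.append_nil, List.map_flatMap]

/-- The reversed word is what results from moving the input letter by letter onto a stack, and what
the parser expects. Bounds in this encoding are bounds in the length of the written input. -/
instance : Enc (Input L) := ⟨fun w => Enc.enc (encodeInput Naming.name w).reverse⟩

theorem polyTime_parseInput : PolyTime fun w : Input L => (w.terms, w.terms.flatMap subterms) := by
  have h : PolyTime fun l : List Letter => (((parse l).1.headD ([], [])).1, (parse l).2) :=
    (PolyTime.fst.comp ((PolyTime.listCases (PolyTime.fst.comp polyTime_parse)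
      (.const (([], []) : List BTree × List Bool)) .fst).of_eq
      (g := fun l => (parse l).1.headD ([], [])) fun l => by
        cases (parse l).1 <;> rfl)).pair (PolyTime.snd.comp polyTime_parse)
  refine h.of_enc_eq (fun w => (encodeInput Naming.name w).reverse) (fun w => rfl) fun w => ?_
  rw [parse_encodeInput, enc_mk, enc_mk, List.headD_cons, enc_map_enc, enc_map_enc]

end parse

/-! ### The word problem in polynomial time on encoded inputs. -/

/-- Group consecutive elements of a list into pairs. -/
def pairUpStep {α : Type} (x : α) : List α × List (α × α) → List α × List (α × α)
  | ([], acc) => ([x], acc)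
  | (y :: _, acc) => ([], (y, x) :: acc)

theorem foldl_pairUpStep {α : Type} (P acc : List (α × α)) :
    (P.flatMap fun p => [p.1, p.2]).foldl (fun s x => pairUpStep x s) ([], acc) =
      ([], P.reverse ++ acc) := by
  induction P generalizing acc with
  | nil => rfl
  | cons p P ih =>
    rw [List.flatMap_cons, List.foldl_append]
    exact (ih (p :: acc)).trans (by simp)

theorem polyTime_pairUp {α β : Type} [Enc α] [Enc β] {l : α → List β} (hl : PolyTime l) :
    PolyTime fun x => ((l x).foldl (fun s x => pairUpStep x s) ([], [])).2.reverse := by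
  have hs : PolyTime fun y : β × (List β × List (β × β)) => pairUpStep y.1 y.2 :=
    (PolyTime.listCases (PolyTime.fst.comp .snd)
      ((PolyTime.fst.cons (.const [])).pair (PolyTime.snd.comp .snd))
      (k := fun z : β × List β × (β × (List β × List (β × β))) =>
        (([], (z.1, z.2.2.1) :: z.2.2.2.2) : List β × List (β × β)))
      ((PolyTime.const []).pair ((PolyTime.fst.pair (PolyTime.fst.comp (PolyTime.snd.comp .snd))).cons
        (PolyTime.snd.comp (PolyTime.snd.comp (PolyTime.snd.comp .snd)))))).of_eq fun y => by
      rcases y with ⟨x, _ | ⟨y, l⟩, acc⟩ <;> rfl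
  have hsz : ∀ (l : List β) (s : List β × List (β × β)),
      sz (l.foldl (fun s x => pairUpStep x s) s) + 1 ≤ sz s + sz l := by
    intro l
    induction l with
    | nil => simp
    | cons x l ih =>
      intro s
      have h := ih (pairUpStep x s)
      have h' : sz (pairUpStep x s) ≤ sz s + sz x + 1 := by
        rcases s with ⟨_ | ⟨y, l⟩, acc⟩
        · simp [pairUpStep]; omega
        · have := one_le_sz l
          simp [pairUpStep]; omega
      rw [List.foldl_cons, sz_cons]
      omega
  obtain ⟨q, hq⟩ := hl.exists_sz_le
  refine .reverse (PolyTime.snd.comp (PolyTime.foldl_aux (f := fun y => pairUpStep y.1 y.2) hl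
    (.const ([], [])) hs (q + 3) fun x l' hl' => ?_))
  have h₁ := hsz l' ([], [])
  have h₂ := (sz_le_of_prefix hl').trans (hq x)
  have h₃ : sz (([], []) : List β × List (β × β)) = 3 := rfl
  rw [Polynomial.eval_add, Polynomial.eval_ofNat]
  change sz (l'.foldl (fun s x => pairUpStep x s) ([], [])) ≤ _
  omega

/-- The congruence closure decides the word problem in polynomial time. -/
theorem polyTime_wordProblem {L : FirstOrder.Language.{0, 0}} [Naming L] {E : Set (Equation L)}
    (hEfin : E.Finite) (hE : ∀ e ∈ E, IsPermutationEquation e)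
    {B : L.Functions 2 → Option (InterpretedBy L)} (hB : {g | B g ≠ none}.Finite) :
    PolyTime (wordProblem E B) := by
  obtain ⟨perms, hperms⟩ := exists_permRules hEfin
  obtain ⟨ints, hints⟩ := exists_interpreted hB
  have hP : PolyTime fun w : Input L => (w.s, w.t) :: w.P :=
    (polyTime_pairUp (PolyTime.fst.comp polyTime_parseInput)).of_eq fun w => by
      simp only [Input.terms, foldl_pairUpStep, List.append_nil, List.reverse_reverse]
  have hT : PolyTime fun w : Input L => inputTerms ints w :=
    ((PolyTime.snd.comp polyTime_parseInput).append
      (.const (ints.flatMap fun c => c.2.constants.flatMap subterms))).of_eq fun w => by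
      rw [Input.terms, List.flatMap_assoc, inputTerms]
      simp only [List.flatMap_cons, List.flatMap_nil, List.append_nil]
  have hC := PolyTime.closure perms ints hT (hP.tail (l := fun w => (w.s, w.t) :: w.P))
  -- The first pair in the parsed list is `(s, t)`; `any` on this one-element list tests whether the
  -- closure contains it.
  refine (hP.take_one.any (p := fun w (p : GroundTerm L × GroundTerm L) =>
    rel (closure perms ints (inputTerms ints w) w.P) p.1 p.2)
    ((hC.comp .fst).rel (.comp .fst .snd) (.comp .snd .snd))).of_eq fun w => ?_
  rw [wordProblem_eq hperms hE hints]
  simp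

/-! ### The Turing machine: reading the input and writing the answer. -/

namespace Prg

/-- Pop a letter into the register. -/
def popInp : Prg := .pop .inp fun v o => (v.1, v.2.1, o)

/-- Turn the tree on the main stack into the list with the letter `a` prepended. -/
def consLetter (a : Letter) : Prg := pushList (true :: (Enc.enc a : BTree).code)

/-- Turn the tree on the main stack into the list with the letter in the register prepended. -/
def consReg : Prg :=
  .ite (fun v => v.2.2 == some .lp) (consLetter .lp)
    (.ite (fun v => v.2.2 == some .rp) (consLetter .rp)
      (.ite (fun v => v.2.2 == some (.bit true)) (consLetter (.bit true)) (consLetter (.bit false))))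

/-- The loop that reads the input. -/
def readLoop : Prg := .loop (fun v => v.2.2.isSome) (.seq consReg popInp)

/-- Read the input, apply a program, and write the resulting truth value. -/
def decider (p : Prg) : Prg :=
  -- The initial `false` is the code of the empty list, to which the letters are prepended. At the
  -- end the tree code of the truth value is replaced by a single bit.
  .seq (pushC .main false) (.seq popInp (.seq readLoop (.seq p (.seq (popX .main)
    (.seq (.ite (fun v => v.1 == some true)
      (.seq (popX .main) (.seq (popX .main) (pushC .main true))) (pushC .main false)) reset)))))

end Prg

theorem exec_popInp (v : Reg) (I : List Letter) (S : WStk → List Bool) :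
    ExecI Prg.popInp v I S (v.1, v.2.1, I.head?) I.tail S 1 := by
  have h := Run.pop (Γ := Sig) .inp (fun (v : Reg) o => (v.1, v.2.1, o)) v (store I S)
  rw [update_store_inp] at h
  exact h

theorem exec_consReg (a : Letter) (I : List Letter) (r : List Bool) : ∃ n ≤ 13,
    ExecI Prg.consReg (none, none, some a) I (ms r) r0 I
      (ms (true :: ((Enc.enc a : BTree).code ++ r))) n := by
  have h : ExecI (Prg.consLetter a) (none, none, some a) I (ms r) r0 I
      (ms (true :: ((Enc.enc a : BTree).code ++ r))) _ := exec_pushList _ r _ I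
  -- At most seven bits for the letter, one node bit, and one step for the reset.
  have hn : (true :: (Enc.enc a : BTree).code).length + 1 ≤ 9 := by
    have := sz_letter_le a
    simp [sz] at this ⊢
    omega
  rcases a with _ | _ | _ | _
  · exact ⟨_, by omega, .iteTrue rfl h⟩
  · exact ⟨_, by omega, .iteFalse rfl (.iteTrue rfl h)⟩
  · exact ⟨_, by omega, .iteFalse rfl (.iteFalse rfl (.iteFalse rfl h))⟩
  · exact ⟨_, by omega, .iteFalse rfl (.iteFalse rfl (.iteTrue rfl h))⟩

theorem exec_readLoop (l acc : List Letter) : ∃ n ≤ 20 * l.length + 1,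
    ExecI Prg.readLoop (none, none, l.head?) l.tail (ms (Enc.enc acc).code) r0 []
      (ms (Enc.enc (l.reverse ++ acc)).code) n := by
  induction l generalizing acc with
  | nil => exact ⟨1, by simp, Run.loopFalse rfl⟩
  | cons a l ih =>
    obtain ⟨n, hn, e⟩ := ih (a :: acc)
    obtain ⟨m, hm, e'⟩ := exec_consReg a l (Enc.enc acc).code
    refine ⟨(m + 1) + 1 + n, by simp; omega, ?_⟩
    rw [List.reverse_cons, List.append_assoc]
    exact Run.loopTrue rfl (.seq e' (exec_popInp _ _ _)) e

theorem sz_letters_le (l : List Letter) : sz l ≤ 8 * l.length + 1 := by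
  have := sz_le_length_mul (l := l) fun a _ => sz_letter_le a
  omega

instance : Fintype Letter := ⟨{.lp, .rp, .bit true, .bit false}, fun a => by
  rcases a with _ | _ | _ | _ <;> simp⟩

/-- The Turing machine that executes a program and accepts or rejects. -/
noncomputable def machine (p : Prg) : Turing.FinTM2 where
  K := Stk
  k₀ := .inp
  k₁ := .wk .main
  Γ := Sig
  Λ := p.Lab
  main := p.entry
  ΛFin := Fintype.ofFinite _
  σ := Reg
  initialState := r0
  Γk₀Fin := inferInstanceAs (Fintype Letter)
  m := p.code id .halt

theorem initList_machine (p : Prg) (l : List Letter) :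
    Turing.initList (machine p) l = ⟨some p.entry, r0, store l (ms [])⟩ := by
  simp only [Turing.initList]
  congr 1
  funext k
  rcases k with _ | i
  · rfl
  · cases i <;> rfl

theorem haltList_machine (p : Prg) (b : Bool) :
    Turing.haltList (machine p) [b] = ⟨none, r0, store [] (ms [b])⟩ := by
  simp only [Turing.haltList]
  congr 1
  funext k
  rcases k with _ | i
  · rfl
  · cases i <;> rfl

/-- A predicate that is decided in polynomial time on trees is decided in polynomial time by a
Turing machine. -/
theorem PolyTime.nonempty_tm2 {α : Type} [Enc α] {f : α → Bool} (hf : PolyTime f)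
    (e : α → List Letter) (he : ∀ x, Enc.enc x = Enc.enc (e x).reverse) :
    Nonempty (Turing.TM2ComputableInPolyTime e Computability.encodeBool f) := by
  obtain ⟨p, q, hp⟩ := hf
  refine ⟨⟨⟨machine (Prg.decider p), Equiv.refl Letter, Equiv.refl Bool⟩,
    -- Reading takes at most 20 steps per letter. The encoded list has size at most 8 per letter
    -- plus 1: up to seven for the letter and one for the list cell.
    20 * .X + q.comp (8 * .X + 1) + 20, fun x => ?_⟩⟩
  have key : ∃ n ≤ 20 * (e x).length + q.eval (8 * (e x).length + 1) + 20,
      Run (Prg.decider p) r0 (store (e x) (ms [])) r0 (store [] (ms [f x])) n := by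
    have e₁ := exec_pushC (i := .main) (v := r0) (I := e x) (b := false) (S := ms [])
    simp only [update_ws_main, ws_main] at e₁
    have e₂ := exec_popInp r0 (e x) (ms [false])
    obtain ⟨n₃, hn₃, e₃⟩ := exec_readLoop (e x) []
    obtain ⟨n₄, hn₄, e₄⟩ := (hp x).2 []
    have hx : sz x ≤ 8 * (e x).length + 1 := by
      have := sz_letters_le (e x).reverse
      rw [List.length_reverse] at this
      unfold sz at this ⊢
      rwa [he]
    replace hn₄ := hn₄.trans (eval_mono q hx)
    rw [he, List.append_nil, List.append_nil] at e₄
    rw [List.append_nil] at e₃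
    cases hb : f x with
    | true =>
      rw [hb] at e₄
      have e₅ := exec_pushC (i := .main) (v := (some false, none, none)) (I := []) (b := true)
        (S := ms [])
      simp only [update_ws_main, ws_main] at e₅
      exact ⟨1 + (1 + (n₃ + (n₄ + (1 + (((1 + (1 + 1)) + 1) + 1))))), by omega,
        .seq e₁ (.seq e₂ (.seq e₃ (.seq e₄ (.seq (PolyTime.exec_popToken true r0 _) (.seq (.iteTrue rfl
          (.seq (PolyTime.exec_popToken false _ _) (.seq (PolyTime.exec_popToken false _ _) e₅)))
          exec_reset)))))⟩
    | false =>
      rw [hb] at e₄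
      have e₅ := exec_pushC (i := .main) (v := (some false, none, none)) (I := []) (b := false)
        (S := ms [])
      simp only [update_ws_main, ws_main] at e₅
      exact ⟨1 + (1 + (n₃ + (n₄ + (1 + ((1 + 1) + 1))))), by omega,
        .seq e₁ (.seq e₂ (.seq e₃ (.seq e₄ (.seq (PolyTime.exec_popToken false r0 _)
          (.seq (.iteFalse rfl e₅) exec_reset)))))⟩
  choose n hn h using key
  have h' := h.iterate_step (M := (Prg.decider p).code _root_.id .halt) _root_.id .halt fun l => rfl
  refine ⟨⟨n, ?_⟩, ?_⟩
  · have h₁ : (flip bind (machine (Prg.decider p)).step)^[n]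
        (some (Turing.initList (machine (Prg.decider p)) (e x))) =
        some (Turing.haltList (machine (Prg.decider p)) [f x]) := by
      rw [initList_machine, haltList_machine]
      exact h'
    have h₂ : (e x).map (Equiv.refl Letter).invFun = e x := List.map_id _
    exact (congrArg (fun l => (flip bind (machine (Prg.decider p)).step)^[n]
      (some (Turing.initList (machine (Prg.decider p)) l))) h₂).trans h₁
  · simpa using hn

end PermWord

theorem mainTheorem4 (L : FirstOrder.Language.{0, 0})
    (name : (Σ n, L.Functions n) → List Bool) (hname : Function.Injective name)
    (E : Set (PermWord.Equation L)) (hEfin : E.Finite)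
    (hE : ∀ e ∈ E, PermWord.IsPermutationEquation e)
    (B : L.Functions 2 → Option (PermWord.InterpretedBy L)) (hB : {g | B g ≠ none}.Finite) :
    Nonempty (Turing.TM2ComputableInPolyTime (PermWord.encodeInput name) Computability.encodeBool
      (PermWord.wordProblem E B)) :=
  letI : PermWord.Naming L := ⟨name, hname⟩
  (PermWord.polyTime_wordProblem hEfin hE hB).nonempty_tm2 _ fun _ => rfl
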